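/- **Setting.** Let $\mathcal X$ be a closed ball of a real separable Banach space $E$, and let $\mathcal H$ be a separable real reproducing kernel Hilbert space of functions on $\mathcal X$ with measurable kernel $k$ and kernel sections $k_x=k(x,\cdot)$, such that $\sup_{x\in\mathcal X}\sqrt{k(x,x)}\le 1$ and $k$ admits a mixed partial (Gâteaux) derivative $\partial_{1,2}k$ on $\mathcal X\times\mathcal X$ bounded by a constant $K>0$, i.e. $|\partial_{1,2}k(x,y)[u,v]|\le K\|u\|\|v\|$. Put $\bar K:=\max(K,\sqrt K)$ (so $\bar K=K$ if $K\ge1$). Let $Z_j=(X_j,Y_j)$, $j\ge1$, be a process on a probability space with values in $\mathcal X\times\mathbb R$, with common marginal law $\nu$ (as is the case for a stationary process), and let $\mu$ be the $\mathcal X$-marginal of $\nu$. Assume there are $0<R\le1$, $\Sigma>0$, $D$ and $f_\nu\in\mathcal H$ with $\|f_\nu\|_{\mathcal H}\le D$ such that $|Y|\le R$ $\nu$-a.s., and, for $\mu$-almost all $x$, $\int y\,\nu(dy|x)=f_\nu(x)$ and $\int (y-f_\nu(x))^2\,\nu(dy|x)\le\Sigma^2$. The $\tau$-mixing coefficients are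 $$\tau(k)=\sup\bigl\{\|\mathbb E[\varphi(Z_{i+k})\mid\sigma(Z_1,\dots,Z_i)]-\mathbb E[\varphi(Z_{i+k})]\|_{L_\infty}\;:\; i\ge1,\ \varphi \text{ bounded and } 1\text{-Lipschitz}\bigr\},$$ where Lipschitz refers to the metric $\|x-x'\|+|y-y'|$. Let $T=\int k_x\otimes k_x^*\,\mu(dx)$, and, for the sample $(x_j,y_j)=(X_j,Y_j)$, $1\le j\le n$, with $n\ge1$, let $T_{\mathbf x}=\frac1n\sum_{j=1}^n k_{x_j}\otimes k_{x_j}^*$ and $S_{\mathbf x}^*\mathbf y=\frac1n\sum_{j=1}^n y_jk_{x_j}$. For $\lambda>0$ let $\mathcal N(\lambda)=\mathrm{Tr}((T+\lambda)^{-1}T)$. **Statement.** For all $\eta\in(0,1/2]$ and $\lambda>0$, each of the following four events has probability at least $1-\eta$: $$\|T_{\mathbf x}f_\nu-S_{\mathbf x}^*\mathbf y\|\le 21\log(2\eta^{-1})\Bigl(\frac{\Sigma}{\sqrt{\ell_1}}+\frac{2R}{\ell_1}\Bigr),$$ $$\|(T+\lambda)^{-1/2}(T_{\mathbf x}f_\nu-S_{\mathbf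 x}^*\mathbf y)\|\le 21\log(2\eta^{-1})\Bigl(\frac{\Sigma\sqrt{\mathcal N(\lambda)}}{\sqrt{\ell_2}}+\frac{2R}{\sqrt\lambda\,\ell_2}\Bigr),$$ $$\|(T+\lambda)^{-1/2}(T-T_{\mathbf x})\|\le 21\log(2\eta^{-1})\Bigl(\frac{\sqrt{\mathcal N(\lambda)}}{\sqrt{\ell_3}}+\frac{2}{\sqrt\lambda\,\ell_3}\Bigr),$$ $$\|T-T_{\mathbf x}\|\le 42\,\frac{\log(2\eta^{-1})}{\sqrt{\ell_4}},$$ where in the last two events the bound holds simultaneously for the operator norm and the Hilbert–Schmidt norm. With $C:=3\max(1,\bar KR,\bar KD)$, this holds for the following choices of $\ell_1,\dots,\ell_4$. (a) General rate. If $\tau(k)\le t(k)$ for all $k\ge1$, one can take the effective sample sizes $\ell_i=\ell^\star(\delta_i,c_i,\sigma_i)$, where $$\ell^\star(\delta,c,\sigma)=\max\Bigl(\Bigl\{1\le\ell\le n:\ \delta(\lfloor n/\ell\rfloor)\le \frac c\ell\vee\frac{\sigma}{\sqrt\ell}\Bigr\}\cup\{1\}\Bigr)$$ and $(\delta_1,c_1,\sigma_1)=(C\,t,\,2R,\,\Sigma)$,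 $(\delta_2,c_2,\sigma_2)=(C\lambda^{-1/2}t,\,2R\lambda^{-1/2},\,\Sigma\sqrt{\mathcal N(\lambda)})$, $(\delta_3,c_3,\sigma_3)=(2\bar K\lambda^{-1/2}t,\,2\lambda^{-1/2},\,\sqrt{\mathcal N(\lambda)})$, $(\delta_4,c_4,\sigma_4)=(2\bar K t,\,2,\,2)$. In (b) and (c), $\lfloor a\rfloor_n:=\max(1,\min(n,\lfloor a\rfloor))$. (b) Exponential rate. If $\tau(k)\le\chi\exp(-(\theta k)^\gamma)$ for all $k\ge1$, with $\chi,\theta,\gamma>0$, one can take $$\ell_1=\ell_2=\left\lfloor\frac{n\theta}{2\bigl(1\vee\log\bigl(n\frac{C\chi\theta}{2R}\bigr)\bigr)^{1/\gamma}}\right\rfloor_n,\qquad \ell_3=\ell_4=\left\lfloor\frac{n\theta}{2\bigl(1\vee\log(n\bar K\theta\chi)\bigr)^{1/\gamma}}\right\rfloor_n .$$ (c) Polynomial rate. If $\tau(k)\le\rho k^{-\gamma}$ for all $k\ge1$, with $\rho,\gamma>0$, one can take $$\ell_i=\left\lfloor q_i^{\frac2{2\gamma+1}}\Bigl(\frac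 n2\Bigr)^{\frac{2\gamma}{2\gamma+1}}\right\rfloor_n,\qquad q_1=\frac{\Sigma}{C\rho},\quad q_2=\frac{\Sigma\sqrt{\lambda\mathcal N(\lambda)}}{C\rho},\quad q_3=\frac{\sqrt{\lambda\mathcal N(\lambda)}}{2\bar K\rho},\quad q_4=\frac1{\bar K\rho}.$$ -/

import Mathlib

open MeasureTheory ProbabilityTheory
open scoped ENNReal NNReal

noncomputable section

namespace TauMixRKHS

/-! ### Inverse square root, trace and Hilbert–Schmidt norm on a real Hilbert space -/

section Operators

variable {H : Type*} [NormedAddCommGroup H] [InnerProductSpace ℝ H] [CompleteSpace H]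

/-- `A` is an inverse square root of the (bounded, self-adjoint, positive definite) operator `S`:
`A` is positive and `A² S = 1`. By uniqueness of positive square roots there is at most
one such `A`. -/
def IsInvSqrt (S A : H →L[ℝ] H) : Prop := A.IsPositive ∧ A * A * S = 1

/-- Existence of `(T + lam)^{-1/2}` for a positive operator `T` and `lam > 0`. -/
theorem exists_isInvSqrt {T : H →L[ℝ] H} (hT : T.IsPositive) {lam : ℝ} (hlam : 0 < lam) :
    ∃ A : H →L[ℝ] H, IsInvSqrt (T + lam • (1 : H →L[ℝ] H)) A := by
  set M := ‖T‖ with hM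
  have hM0 : 0 ≤ M := norm_nonneg _
  have hm : 0 < M + lam := by positivity
  set q : ℝ := M / (M + lam) with hq
  have hq0 : 0 ≤ q := by positivity
  have hq1 : q < 1 := by rw [hq, div_lt_one hm]; linarith
  set B : H →L[ℝ] H := (M + lam)⁻¹ • (M • (1 : H →L[ℝ] H) - T) with hB
  have hTs : IsSelfAdjoint T := hT.isSelfAdjoint
  have h1s : IsSelfAdjoint (1 : H →L[ℝ] H) := IsSelfAdjoint.one _
  have hBs : IsSelfAdjoint B :=
    IsSelfAdjoint.smul (IsSelfAdjoint.all _) ((IsSelfAdjoint.smul (IsSelfAdjoint.all _) h1s).sub hTs)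
  have hBn : ‖B‖ ≤ q := by
    have hs : IsSelfAdjoint (M • (1 : H →L[ℝ] H) - T) :=
      (IsSelfAdjoint.smul (IsSelfAdjoint.all _) h1s).sub hTs
    have : ‖M • (1 : H →L[ℝ] H) - T‖ ≤ M := by
      rw [ContinuousLinearMap.norm_eq_iSup_rayleighQuotient _ hs.isSymmetric]
      refine ciSup_le fun x => ?_
      rw [ContinuousLinearMap.rayleighQuotient, abs_div, abs_of_nonneg (sq_nonneg ‖x‖)]
      refine div_le_of_le_mul₀ (sq_nonneg _) hM0 ?_
      have e : (M • (1 : H →L[ℝ] H) - T).reApplyInnerSelf x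
          = M * ‖x‖ ^ 2 - inner ℝ (T x) x := by
        simp [ContinuousLinearMap.reApplyInnerSelf_apply, inner_sub_left, inner_smul_left]
      have a1 : 0 ≤ inner ℝ (T x) x := hT.inner_nonneg_left x
      have a2 : inner ℝ (T x) x ≤ M * ‖x‖ ^ 2 := by
        calc inner ℝ (T x) x ≤ ‖T x‖ * ‖x‖ := real_inner_le_norm _ _
          _ ≤ (M * ‖x‖) * ‖x‖ := by gcongr; exact T.le_opNorm x
          _ = M * ‖x‖ ^ 2 := by ring
      rw [e, abs_of_nonneg (by linarith)]
      linarith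
    rw [hB, norm_smul, norm_inv, Real.norm_of_nonneg hm.le, hq, div_eq_inv_mul]
    gcongr
  -- a fixed point of `Y ↦ (B + Y²) / 2` among the self-adjoint operators of norm at most `q`
  set Φ : (H →L[ℝ] H) → (H →L[ℝ] H) := fun Y => (1 / 2 : ℝ) • (B + Y * Y) with hΦ
  set s : Set (H →L[ℝ] H) := {Y | IsSelfAdjoint Y} ∩ Metric.closedBall 0 q with hs
  have hsc : IsComplete s := by
    refine IsClosed.isComplete (IsClosed.inter ?_ Metric.isClosed_closedBall)
    exact isClosed_eq continuous_star continuous_id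
  have hmaps : Set.MapsTo Φ s s := by
    rintro Y ⟨hY, hYq⟩
    have hYs : IsSelfAdjoint Y := hY
    rw [mem_closedBall_zero_iff] at hYq
    refine ⟨IsSelfAdjoint.smul (IsSelfAdjoint.all _)
      (hBs.add (by rw [← sq]; exact hYs.pow 2)), ?_⟩
    rw [mem_closedBall_zero_iff]
    have : ‖Y * Y‖ ≤ q * q := (norm_mul_le _ _).trans (by gcongr)
    calc ‖Φ Y‖ ≤ (1 / 2 : ℝ) * (‖B‖ + ‖Y * Y‖) := by
          rw [hΦ]; simp only [norm_smul]; norm_num; exact norm_add_le _ _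
      _ ≤ (1 / 2 : ℝ) * (q + q * q) := by gcongr
      _ ≤ q := by nlinarith
  have hcontr : ContractingWith ⟨q, hq0⟩ (hmaps.restrict Φ s s) := by
    refine ⟨by exact_mod_cast hq1, LipschitzWith.of_dist_le_mul ?_⟩
    rintro ⟨Y, hY⟩ ⟨W, hW⟩
    have hY1 := mem_closedBall_zero_iff.1 hY.2
    have hW1 := mem_closedBall_zero_iff.1 hW.2
    change dist (Φ Y) (Φ W) ≤ q * dist Y W
    rw [dist_eq_norm, dist_eq_norm]
    have e : Φ Y - Φ W = (1 / 2 : ℝ) • (Y * (Y - W) + (Y - W) * W) := by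
      simp only [hΦ, ← smul_sub]; congr 1; noncomm_ring
    have t1 : ‖Y * (Y - W)‖ ≤ q * ‖Y - W‖ := (norm_mul_le _ _).trans (by gcongr)
    have t2 : ‖(Y - W) * W‖ ≤ ‖Y - W‖ * q := (norm_mul_le _ _).trans (by gcongr)
    rw [e, norm_smul]
    have := norm_add_le (Y * (Y - W)) ((Y - W) * W)
    norm_num
    linarith
  obtain ⟨Y, ⟨hYs, hYq⟩, hfix, -⟩ := ContractingWith.exists_fixedPoint' hsc hmaps hcontr
    (x := 0) ⟨IsSelfAdjoint.zero _, by simpa using hq0⟩ (edist_ne_top _ _)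
  have hYs' : IsSelfAdjoint Y := hYs
  rw [mem_closedBall_zero_iff] at hYq
  have hY2 : (1 / 2 : ℝ) • (B + Y * Y) = Y := hfix
  have hYY : Y * Y = (2 : ℝ) • Y - B := by
    nth_rewrite 3 [← hY2]; rw [smul_smul]; norm_num
  have hRR : (1 - Y) * (1 - Y) = (M + lam)⁻¹ • (T + lam • (1 : H →L[ℝ] H)) := by
    have : (1 - Y) * (1 - Y) = 1 - (2 : ℝ) • Y + Y * Y := by rw [two_smul]; noncomm_ring
    rw [this, hYY]
    have h2 : (1 : H →L[ℝ] H) = (M + lam)⁻¹ • ((M + lam) • (1 : H →L[ℝ] H)) := by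
      rw [smul_smul, inv_mul_cancel₀ hm.ne', one_smul]
    calc 1 - (2 : ℝ) • Y + ((2 : ℝ) • Y - B) = 1 - B := by abel
      _ = (M + lam)⁻¹ • ((M + lam) • (1 : H →L[ℝ] H)) - B := by rw [← h2]
      _ = _ := by rw [hB, ← smul_sub]; congr 1; rw [add_smul]; abel
  have hRu : IsUnit (1 - Y) := isUnit_one_sub_of_norm_lt_one (hYq.trans_lt hq1)
  have hRs : IsSelfAdjoint (1 - Y) := h1s.sub hYs'
  have hRp : (1 - Y).IsPositive := by
    rw [ContinuousLinearMap.isPositive_iff']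
    refine ⟨hRs, fun x => ?_⟩
    have : inner ℝ (Y x) x ≤ ‖x‖ ^ 2 := by
      calc inner ℝ (Y x) x ≤ ‖Y x‖ * ‖x‖ := real_inner_le_norm _ _
        _ ≤ (‖Y‖ * ‖x‖) * ‖x‖ := by gcongr; exact Y.le_opNorm x
        _ ≤ (1 * ‖x‖) * ‖x‖ := by gcongr; linarith
        _ = ‖x‖ ^ 2 := by ring
    have e : inner ℝ ((1 - Y) x) x = ‖x‖ ^ 2 - inner ℝ (Y x) x := by
      simp [inner_sub_left]
    rw [e]
    linarith
  obtain ⟨u, hu⟩ := hRu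
  set V : H →L[ℝ] H := ((u⁻¹ : (H →L[ℝ] H)ˣ) : H →L[ℝ] H) with hV
  have hRV : (1 - Y) * V = 1 := by rw [← hu, hV, Units.mul_inv]
  have hVR : V * (1 - Y) = 1 := by rw [← hu, hV, Units.inv_mul]
  have hRVx : ∀ x, (1 - Y) (V x) = x := fun x => DFunLike.congr_fun hRV x
  have hVp : V.IsPositive := by
    rw [ContinuousLinearMap.isPositive_iff]
    refine ⟨fun x y => ?_, fun x => ?_⟩
    · have := hRp.inner_left_eq_inner_right (V x) (V y)
      rw [hRVx, hRVx] at this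
      exact this.symm
    · have := hRp.inner_nonneg_right (V x)
      rwa [hRVx] at this
  refine ⟨(√(M + lam))⁻¹ • V, ?_, ?_⟩
  · exact hVp.smul_of_nonneg (by positivity)
  · have hS : T + lam • (1 : H →L[ℝ] H) = (M + lam) • ((1 - Y) * (1 - Y)) := by
      rw [hRR, smul_smul, mul_inv_cancel₀ hm.ne', one_smul]
    have e : V * V * ((1 - Y) * (1 - Y)) = 1 := by
      rw [mul_assoc, ← mul_assoc V (1 - Y), hVR, one_mul, hVR]
    rw [hS, smul_mul_smul_comm, smul_mul_smul_comm, e, ← mul_inv,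
      Real.mul_self_sqrt hm.le, inv_mul_cancel₀ hm.ne', one_smul]

open Classical in
/-- The operator `S^{-1/2}` (the zero operator if `S` has no inverse square root). -/
def invSqrt (S : H →L[ℝ] H) : H →L[ℝ] H :=
  if h : ∃ A, IsInvSqrt S A then h.choose else 0

theorem isInvSqrt_invSqrt {T : H →L[ℝ] H} (hT : T.IsPositive) {lam : ℝ} (hlam : 0 < lam) :
    IsInvSqrt (T + lam • (1 : H →L[ℝ] H)) (invSqrt (T + lam • (1 : H →L[ℝ] H))) := by
  have h := exists_isInvSqrt hT hlam
  rw [invSqrt, dif_pos h]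
  exact h.choose_spec

variable (H) in
/-- A Hilbert (orthonormal) basis of `H`. -/
def onb : HilbertBasis (exists_hilbertBasis ℝ H).choose ℝ H :=
  (exists_hilbertBasis ℝ H).choose_spec.choose

/-- The trace `∑ᵢ ⟨eᵢ, A eᵢ⟩` (used for positive trace-class operators). -/
def opTrace (A : H →L[ℝ] H) : ℝ := ∑' i, inner ℝ (onb H i) (A (onb H i))

/-- The Hilbert–Schmidt norm `(∑ᵢ ‖A eᵢ‖²)^{1/2}`, with value `∞` if `A` is not
Hilbert–Schmidt. -/
def hsNorm (A : H →L[ℝ] H) : ℝ≥0∞ := (∑' i, ‖A (onb H i)‖ₑ ^ 2) ^ (1 / 2 : ℝ)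

/-- The effective dimension `N(lam) = Tr((T + lam)⁻¹ T)`. -/
def effDim (T : H →L[ℝ] H) (lam : ℝ) : ℝ :=
  opTrace (Ring.inverse (T + lam • (1 : H →L[ℝ] H)) * T)

end Operators

/-! ### Reproducing kernel Hilbert space and the (empirical) operators -/

section Kernel

variable {X : Type*} {H : Type*} [NormedAddCommGroup H] [InnerProductSpace ℝ H] [CompleteSpace H]
  [RKHS ℝ H X ℝ]

variable (H) in
/-- The real-valued reproducing kernel `k(x, y)` of `H`. -/
def ker (x y : X) : ℝ := RKHS.kernel H x y 1

variable (H) in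
/-- The kernel section `k_x = k(x, ·) ∈ H`. -/
def feat (x : X) : H := RKHS.kerFun H x 1

variable (H) in
/-- The rank-one operator `T_x = k_x ⊗ k_x^* : f ↦ ⟨k_x, f⟩ k_x`. -/
def rankOneOp (x : X) : H →L[ℝ] H := InnerProductSpace.rankOne ℝ (feat H x) (feat H x)

variable (H) in
/-- The covariance operator `T = ∫ T_x μ(dx)`. -/
def covOp [MeasurableSpace X] (μ : Measure X) : H →L[ℝ] H := ∫ x, rankOneOp H x ∂μ

variable (H) in
/-- The empirical covariance operator `T_𝐱 = n⁻¹ ∑ⱼ k_{xⱼ} ⊗ k_{xⱼ}^*`. -/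
def empCovOp {n : ℕ} (x : Fin n → X) : H →L[ℝ] H := (n : ℝ)⁻¹ • ∑ j, rankOneOp H (x j)

variable (H) in
/-- `S_𝐱^* 𝐲 = n⁻¹ ∑ⱼ yⱼ k_{xⱼ}`. -/
def empAdj {n : ℕ} (x : Fin n → X) (y : Fin n → ℝ) : H := (n : ℝ)⁻¹ • ∑ j, y j • feat H (x j)

/-- The kernel `k` on the set `s` admits a mixed partial (Gâteaux) derivative `∂₁₂ k` which is
bounded by `K`: for all `x, y ∈ s` and directions `u, v`, the function `k(·, y)` has at `x` a
derivative `d₁(x, y; u)` in direction `u`, the function `d₁(x, ·; u)` has at `y` a derivative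
`d₁₂(x, y; u, v)` in direction `v`, and `|d₁₂(x, y; u, v)| ≤ K ‖u‖ ‖v‖`. All derivatives are
taken within `s`, so the values of the extensions by `0` outside `s` play no role. -/
def HasBoundedMixedDeriv {E : Type*} [NormedAddCommGroup E] [NormedSpace ℝ E] {s : Set E}
    (k : s → s → ℝ) (K : ℝ) : Prop :=
  ∃ (d₁ : s → s → E → ℝ) (d₁₂ : s → s → E → E → ℝ), ∀ (x y : s) (u v : E),
    HasLineDerivWithinAt ℝ (Function.extend Subtype.val (fun x' : s => k x' y) 0)
      (d₁ x y u) s (x : E) u ∧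
    HasLineDerivWithinAt ℝ (Function.extend Subtype.val (fun y' : s => d₁ x y' u) 0)
      (d₁₂ x y u v) s (y : E) v ∧
    |d₁₂ x y u v| ≤ K * ‖u‖ * ‖v‖

/-- The class of distributions `𝒟(R, Sig)`: `|Y| ≤ R`, the regression function is (`μ`-a.e.) the
element `f` of `H`, and the conditional variance is at most `Sig²`. Here `ν.fst` is the
`X`-marginal `μ` of `ν` and `ν.condKernel x` is the regular conditional probability `ν(dy | x)`. -/
structure RegressionClass [MeasurableSpace X] (ν : Measure (X × ℝ)) [IsProbabilityMeasure ν]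
    (f : H) (R Sig : ℝ) : Prop where
  R_pos : 0 < R
  R_le_one : R ≤ 1
  Sig_pos : 0 < Sig
  bounded : ∀ᵐ z ∂ν, |z.2| ≤ R
  regression : ∀ᵐ x ∂ν.fst, ∫ y, y ∂(ν.condKernel x) = f x
  variance : ∀ᵐ x ∂ν.fst, ∫ y, (y - f x) ^ 2 ∂(ν.condKernel x) ≤ Sig ^ 2

end Kernel

/-! ### The mixing coefficients -/

section Mixing

variable {Ω : Type*} {X : Type*}

/-- The past sigma-algebra `σ(Z_0, …, Z_i)` (time starts at `0`). -/
abbrev past {S : Type*} [MeasurableSpace S] (Z : ℕ → Ω → S) (i : ℕ) : MeasurableSpace Ω :=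
  ⨆ j ≤ i, MeasurableSpace.comap (Z j) inferInstance

/-- Bounded functions on `X × ℝ` with Lipschitz constant at most `1` for the metric
`d(x, x') + |y - y'|`. -/
def lipTest (X : Type*) [PseudoMetricSpace X] : Set (X × ℝ → ℝ) :=
  {φ | (∃ M, ∀ z, |φ z| ≤ M) ∧ ∀ z w, |φ z - φ w| ≤ dist z.1 w.1 + |z.2 - w.2|}

/-- The `τ`-mixing coefficient `τ(k) = sup_{φ, i} ‖E[φ(Z_{i+k}) | M_i] - E[φ(Z_{i+k})]‖_∞`, where
`φ` runs over the bounded `1`-Lipschitz functions. (If the `y`-component of `Z` lies in `[-R, R]`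
almost surely, test functions on `X × [-R, R]` give the same value, since each of them extends to a
bounded `1`-Lipschitz function on `X × ℝ`.) -/
def tauCoeff [PseudoMetricSpace X] [MeasurableSpace X] [MeasurableSpace Ω] (P : Measure Ω)
    (Z : ℕ → Ω → X × ℝ) (k : ℕ) : ℝ≥0∞ :=
  ⨆ φ ∈ lipTest X, ⨆ i : ℕ,
    eLpNorm (fun ω => (P[fun ω' => φ (Z (i + k) ω') | past Z i]) ω
      - ∫ ω', φ (Z (i + k) ω') ∂P) ∞ P

end Mixing

/-! ### Effective sample sizes -/

section EffectiveSampleSize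

open Classical in
/-- The effective sample size
`max ({1 ≤ ℓ ≤ n : δ(⌊n/ℓ⌋) ≤ c/ℓ ∨ σ/√ℓ} ∪ {1})`. -/
def effSize (δ : ℕ → ℝ) (c σ : ℝ) (n : ℕ) : ℕ :=
  max 1 (((Finset.Icc 1 n).filter
    fun ℓ => δ (n / ℓ) ≤ max (c / (ℓ : ℝ)) (σ / √(ℓ : ℝ))).sup id)

/-- `⌊a⌋` restricted to the range `{1, …, n}` of effective sample sizes. -/
def clip (n : ℕ) (a : ℝ) : ℕ := max 1 (min n ⌊a⌋₊)

/-- `⌊n θ / (2 (1 ∨ log (n q))^{1/γ})⌋`, restricted to `{1, …, n}`. -/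
def expSize (n : ℕ) (θ γ q : ℝ) : ℕ :=
  clip n (n * θ / (2 * (max 1 (Real.log (n * q))) ^ (1 / γ)))

/-- `⌊q^{2/(2γ+1)} (n/2)^{2γ/(2γ+1)}⌋`, restricted to `{1, …, n}`. -/
def polySize (n : ℕ) (γ q : ℝ) : ℕ :=
  clip n (q ^ (2 / (2 * γ + 1)) * ((n : ℝ) / 2) ^ (2 * γ / (2 * γ + 1)))

end EffectiveSampleSize

/-! ### The four deviation inequalities -/

section Deviation

variable {Ω : Type*} [MeasurableSpace Ω] {X : Type*} [MeasurableSpace X]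
  {H : Type*} [NormedAddCommGroup H] [InnerProductSpace ℝ H] [CompleteSpace H] [RKHS ℝ H X ℝ]

/-- With `T = ∫ T_x μ(dx)` and the operators of the sample `Z_0, …, Z_{n-1}`, each of the four
deviation inequalities, with the respective effective sample size, holds with probability at
least `1 - η`. The operator inequalities are asserted for both the operator norm and the
Hilbert–Schmidt norm. -/
structure DeviationBounds (P : Measure Ω) (Z : ℕ → Ω → X × ℝ) (μ : Measure X) (f : H)
    (R Sig : ℝ) (n : ℕ) (η lam : ℝ) (ℓ₁ ℓ₂ ℓ₃ ℓ₄ : ℕ) : Prop where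
  first : ENNReal.ofReal (1 - η) ≤ P {ω |
    ‖empCovOp H (fun j : Fin n => (Z j ω).1) f
        - empAdj H (fun j : Fin n => (Z j ω).1) (fun j => (Z j ω).2)‖
      ≤ 21 * Real.log (2 * η⁻¹) * (Sig / √(ℓ₁ : ℝ) + 2 * R / (ℓ₁ : ℝ))}
  second : ENNReal.ofReal (1 - η) ≤ P {ω |
    ‖invSqrt (covOp H μ + lam • (1 : H →L[ℝ] H))
        (empCovOp H (fun j : Fin n => (Z j ω).1) f
          - empAdj H (fun j : Fin n => (Z j ω).1) (fun j => (Z j ω).2))‖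
      ≤ 21 * Real.log (2 * η⁻¹) *
        (Sig * √(effDim (covOp H μ) lam) / √(ℓ₂ : ℝ) + 2 * R / (√lam * (ℓ₂ : ℝ)))}
  third : ENNReal.ofReal (1 - η) ≤ P {ω |
    let A := invSqrt (covOp H μ + lam • (1 : H →L[ℝ] H)) *
      (covOp H μ - empCovOp H (fun j : Fin n => (Z j ω).1))
    let b := 21 * Real.log (2 * η⁻¹) *
      (√(effDim (covOp H μ) lam) / √(ℓ₃ : ℝ) + 2 / (√lam * (ℓ₃ : ℝ)))
    ‖A‖ ≤ b ∧ hsNorm A ≤ ENNReal.ofReal b}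
  fourth : ENNReal.ofReal (1 - η) ≤ P {ω |
    let A := covOp H μ - empCovOp H (fun j : Fin n => (Z j ω).1)
    let b := 42 * (Real.log (2 * η⁻¹) / √(ℓ₄ : ℝ))
    ‖A‖ ≤ b ∧ hsNorm A ≤ ENNReal.ofReal b}

end Deviation

/-- The Lipschitz constant used for the kernel sections: it equals `K` as soon as `K ≥ 1`. -/
def kerLip (K : ℝ) : ℝ := max K (√K)

/-- `C = 3 max(1, K R, K D)`. -/
def constC (K R D : ℝ) : ℝ := 3 * max 1 (max (K * R) (K * D))

end TauMixRKHS

end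

/-!
Each of the four quantities is the norm of an average `n⁻¹ ∑ F (Z j)`, where `F` is a centred,
bounded and Lipschitz function with values in a Hilbert space. For the first two, `F (x, y)` is
`(y - f x) A k_x`, with `A = 1` or `A = (T + lam)^{-1/2}` and with `y` and `f x` truncated to
`[-R, R]`, which changes nothing almost surely and makes `F` a bounded Lipschitz function on the
whole space (`residual`). For the last two, `F (x, y)` is `A (T - k_x ⊗ k_x)` in the space of
Hilbert–Schmidt operators (`HSSpace`). The kernel sections are Lipschitz because `‖k_x - k_x'‖²` is
a mixed difference of the kernel (`norm_feat_sub_le`), and the second moments are controlled by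
`∫ ‖(T + lam)^{-1/2} k_x‖² μ(dx)`, which is the effective dimension (`effDim_eq_integral`).

The probabilistic part is a Bernstein inequality for such averages, `prob_norm_average_le`. The times
`0, …, n - 1` are split into the residue classes modulo `k = ⌊n / ℓ⌋`, each of at least `ℓ` elements,
and by convexity it suffices to bound an exponential moment of the sum over each class. In a Hilbert
space, `cosh ‖w + x‖ ≤ cosh ‖w‖ (1 + ‖x‖²) + ⟪∇, x⟫` for `‖x‖ ≤ 1`, where the gradient `∇` at `w` has
norm at most `cosh ‖w‖` (`cosh_norm_add_le`). If `w` is the sum of the preceding terms of the class,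
then `x` lies at least `k` steps after them, and the mixing coefficient `τ(k)` allows to replace
`‖x‖²` and `⟪∇, x⟫` by their means, up to errors proportional to `τ(k)`
(`abs_integral_mul_sub_le`, `integral_inner_le`). Hence, after rescaling the
terms to norm at most `1`, each of them multiplies the exponential moment by at most
`1 + σ² + 3 L τ(k)`, with `σ²` the second moment and `L` the Lipschitz constant, and the Chernoff bound gives the
deviation `4 log (2 / η) max (c / ℓ) (σ / √ℓ)` as soon as `L τ(k)` is itself at most this maximum, or
`ℓ = 1` (`IsAdmissibleSize`). The sizes given by the general, exponential and polynomial rates are all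
admissible in this sense.
-/

namespace TauMixRKHS

/-! ### Smoothness of the hyperbolic cosine of the norm -/

section SmoothnessOfCosh

/-- Convexity of `u ↦ cosh √u`, seen on its power series. -/
theorem cosh_le_of_sq_eq {a b c θ : ℝ} (h0 : 0 ≤ θ) (h1 : θ ≤ 1)
    (h : c ^ 2 = (1 - θ) * a ^ 2 + θ * b ^ 2) :
    Real.cosh c ≤ (1 - θ) * Real.cosh a + θ * Real.cosh b := by
  refine hasSum_le (fun m => ?_) (Real.hasSum_cosh c)
    (((Real.hasSum_cosh a).mul_left (1 - θ)).add ((Real.hasSum_cosh b).mul_left θ))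
  have key := (convexOn_pow (𝕜 := ℝ) m).2 (Set.mem_Ici.2 (sq_nonneg a))
    (Set.mem_Ici.2 (sq_nonneg b)) (sub_nonneg.2 h1) h0 (by ring)
  simp only [smul_eq_mul] at key
  rw [← h] at key
  simp only [pow_mul]
  calc (c ^ 2) ^ m / ((2 * m).factorial : ℝ)
      ≤ ((1 - θ) * (a ^ 2) ^ m + θ * (b ^ 2) ^ m) / ((2 * m).factorial : ℝ) := by gcongr
    _ = _ := by ring

variable {V : Type*} [NormedAddCommGroup V] [InnerProductSpace ℝ V]

/-- The gradient of `cosh ‖·‖` at `w`; at `w = 0` the convention `0 / 0 = 0` gives the correct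
value `0`. -/
noncomputable def coshGrad (w : V) : V := (Real.sinh ‖w‖ / ‖w‖) • w

theorem norm_coshGrad_le (w : V) : ‖coshGrad w‖ ≤ Real.cosh ‖w‖ := by
  have hs : 0 ≤ Real.sinh ‖w‖ := Real.sinh_nonneg_iff.2 (norm_nonneg _)
  rw [coshGrad, norm_smul, Real.norm_of_nonneg (by positivity)]
  rcases eq_or_ne ‖w‖ 0 with h | h
  · simp [h]
  · rw [div_mul_cancel₀ _ h]; exact (Real.sinh_lt_cosh _).le

/-- First order expansion of `cosh ‖·‖` in a Hilbert space. For fixed norms the left side is a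
convex function of `⟪w, x⟫` and the right side an affine one, so that only the collinear cases
`⟪w, x⟫ = ± ‖w‖ ‖x‖` matter. -/
theorem cosh_norm_add_le_exp (w x : V) :
    Real.cosh ‖w + x‖ ≤
      Real.cosh ‖w‖ * (Real.exp ‖x‖ - ‖x‖) + inner ℝ (coshGrad w) x := by
  have hsb : ‖x‖ ≤ Real.sinh ‖x‖ := Real.self_le_sinh_iff.2 (norm_nonneg _)
  have he : Real.exp ‖x‖ = Real.cosh ‖x‖ + Real.sinh ‖x‖ := (Real.cosh_add_sinh _).symm
  rcases eq_or_ne w 0 with rfl | hw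
  · simp only [coshGrad, zero_add, norm_zero, smul_zero, inner_zero_left, Real.cosh_zero]
    linarith
  rcases eq_or_ne x 0 with rfl | hx
  · simp
  have ha : 0 < ‖w‖ := norm_pos_iff.2 hw
  have hb : 0 < ‖x‖ := norm_pos_iff.2 hx
  have hp := abs_le.1 (abs_real_inner_le_norm w x)
  have hin : inner ℝ (coshGrad w) x = Real.sinh ‖w‖ / ‖w‖ * inner ℝ w x := by
    rw [coshGrad, real_inner_smul_left]
  have hn := norm_add_sq_real w x
  rw [hin]
  set a := ‖w‖
  set b := ‖x‖
  set p : ℝ := inner ℝ w x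
  have hab : 0 < a * b := by positivity
  set q : ℝ := p / (a * b) with hq
  have hpq : p = q * (a * b) := by rw [hq]; field_simp
  have hq1 : q ≤ 1 := by rw [hq, div_le_one hab]; exact hp.2
  have hq0 : -1 ≤ q := by rw [hq, le_div_iff₀ hab]; linarith [hp.1]
  have hc := cosh_le_of_sq_eq (a := a - b) (b := a + b) (c := ‖w + x‖) (θ := (1 + q) / 2)
    (by linarith) (by linarith) (by rw [hn, hpq]; ring)
  rw [Real.cosh_sub, Real.cosh_add] at hc
  have hsa : 0 ≤ Real.sinh a := Real.sinh_nonneg_iff.2 ha.le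
  have hca : Real.sinh a ≤ Real.cosh a := (Real.sinh_lt_cosh a).le
  have h2 : q * Real.sinh a * (Real.sinh b - b) ≤ Real.cosh a * (Real.sinh b - b) := by
    gcongr
    exact (mul_le_of_le_one_left hsa hq1).trans hca
  have h3 : Real.sinh a / a * p = q * Real.sinh a * b := by rw [hpq]; field_simp
  rw [h3, he]
  nlinarith

/-- The form of `cosh_norm_add_le_exp` used for increments of norm at most `1`. The constant `1` of
the quadratic term is not optimal. -/
theorem cosh_norm_add_le (w x : V) (hx : ‖x‖ ≤ 1) :
    Real.cosh ‖w + x‖ ≤ Real.cosh ‖w‖ * (1 + ‖x‖ ^ 2) + inner ℝ (coshGrad w) x := by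
  have h := cosh_norm_add_le_exp w x
  have h2 := (abs_le.1 (Real.abs_exp_sub_one_sub_id_le (x := ‖x‖)
    (by rwa [abs_of_nonneg (norm_nonneg x)]))).2
  have h3 : Real.cosh ‖w‖ * (Real.exp ‖x‖ - ‖x‖) ≤ Real.cosh ‖w‖ * (1 + ‖x‖ ^ 2) := by
    have := Real.cosh_pos ‖w‖
    gcongr
    linarith
  linarith

end SmoothnessOfCosh

/-! ### Decoupling from the past -/

section Decoupling

theorem past_le {Ω S : Type*} [mΩ : MeasurableSpace Ω] [MeasurableSpace S] {Z : ℕ → Ω → S}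
    (hZ : ∀ j, Measurable (Z j)) (i : ℕ) : past Z i ≤ mΩ :=
  iSup₂_le fun j _ => (hZ j).comap_le

theorem measurable_past {Ω S : Type*} [MeasurableSpace S] {Z : ℕ → Ω → S} {i j : ℕ}
    (hj : j ≤ i) : Measurable[past Z i] (Z j) :=
  measurable_iff_comap_le.2 (le_iSup₂_of_le j hj le_rfl)

/-- If `Y` is nearly orthogonal to constants on each event of `m`, it is nearly orthogonal to
bounded `m`-measurable vectors. This stands in for a bound on the norm of `E[Y | m]`. -/
theorem integral_inner_le_of_forall_setIntegral {Ω V : Type*} [NormedAddCommGroup V]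
    [InnerProductSpace ℝ V] {m mΩ : MeasurableSpace Ω} {P : Measure Ω} [IsProbabilityMeasure P]
    (hm : m ≤ mΩ)
    {Y : Ω → V} (hY : StronglyMeasurable Y) {B : ℝ} (hYB : ∀ ω, ‖Y ω‖ ≤ B) {κ : ℝ}
    (h : ∀ (v : V) (s : Set Ω), MeasurableSet[m] s →
      ∫ ω in s, inner ℝ v (Y ω) ∂P ≤ κ * ‖v‖ * P.real s)
    {G : Ω → V} (hG : StronglyMeasurable[m] G) {b : ℝ} (hGb : ∀ ω, ‖G ω‖ ≤ b) :
    ∫ ω, inner ℝ (G ω) (Y ω) ∂P ≤ κ * ∫ ω, ‖G ω‖ ∂P := by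
  have hsm : ∀ f : @SimpleFunc Ω m V, StronglyMeasurable f := fun f =>
    (SimpleFunc.stronglyMeasurable f).mono hm
  have hsb : ∀ f : @SimpleFunc Ω m V, ∃ C, ∀ ω, ‖f ω‖ ≤ C := fun f => by
    obtain ⟨C, hC⟩ := (@SimpleFunc.finite_range Ω V m f).isBounded.exists_norm_le
    exact ⟨C, fun ω => hC _ ⟨ω, rfl⟩⟩
  have hni : ∀ f : @SimpleFunc Ω m V, Integrable (fun ω => ‖f ω‖) P := fun f => by
    obtain ⟨C, hC⟩ := hsb f
    exact Integrable.of_bound (hsm f).norm.aestronglyMeasurable C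
      (ae_of_all _ fun ω => by simpa using hC ω)
  have hii : ∀ f : @SimpleFunc Ω m V, Integrable (fun ω => (inner ℝ (f ω) (Y ω) : ℝ)) P :=
    fun f => by
    obtain ⟨C, hC⟩ := hsb f
    exact Integrable.of_bound ((hsm f).inner hY).aestronglyMeasurable (C * B)
      (ae_of_all _ fun ω => (norm_inner_le_norm _ _).trans
        (mul_le_mul (hC ω) (hYB ω) (norm_nonneg _) ((norm_nonneg _).trans (hC ω))))
  have hsimple : ∀ f : @SimpleFunc Ω m V,
      ∫ ω, inner ℝ (f ω) (Y ω) ∂P ≤ κ * ∫ ω, ‖f ω‖ ∂P := by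
    intro f
    induction f using @SimpleFunc.induction Ω V m _ with
    | @const v s hs =>
      have e1 : ∀ ω, (inner ℝ ((@SimpleFunc.piecewise Ω V m s hs (@SimpleFunc.const Ω V m v)
          (@SimpleFunc.const Ω V m 0)) ω) (Y ω) : ℝ)
          = s.indicator (fun ω => inner ℝ v (Y ω)) ω := fun ω => by
        by_cases hω : ω ∈ s <;> simp [hω]
      have e2 : ∀ ω, ‖(@SimpleFunc.piecewise Ω V m s hs (@SimpleFunc.const Ω V m v)
          (@SimpleFunc.const Ω V m 0)) ω‖ = s.indicator (fun _ => ‖v‖) ω := fun ω => by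
        by_cases hω : ω ∈ s <;> simp [hω]
      simp only [e1, e2]
      rw [integral_indicator (hm s hs), integral_indicator (hm s hs), setIntegral_const,
        smul_eq_mul]
      linarith [h v s hs]
    | @add f g hd hf hg =>
      have e1 : ∀ ω, (inner ℝ ((f + g) ω) (Y ω) : ℝ) = inner ℝ (f ω) (Y ω) + inner ℝ (g ω) (Y ω) :=
        fun ω => inner_add_left _ _ _
      have e2 : ∀ ω, ‖(f + g) ω‖ = ‖f ω‖ + ‖g ω‖ := fun ω => by
        change ‖f ω + g ω‖ = _
        by_cases hω : f ω = 0
        · simp [hω]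
        · have : g ω = 0 := by
            by_contra hg'
            exact Set.disjoint_left.1 hd (Function.mem_support.2 hω) (Function.mem_support.2 hg')
          simp [this]
      simp only [e1, e2]
      rw [integral_add (hii f) (hii g), integral_add (hni f) (hni g)]
      linarith
  have hlim := fun ω => hG.tendsto_approxBounded_of_norm_le (hGb ω)
  have hGb0 : 0 ≤ b := by
    obtain ⟨ω⟩ := nonempty_of_isProbabilityMeasure P
    exact (norm_nonneg _).trans (hGb ω)
  have happ : ∀ j ω, ‖hG.approxBounded b j ω‖ ≤ b := fun j ω =>
    hG.norm_approxBounded_le hGb0 j ω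
  have l1 : Filter.Tendsto (fun j => ∫ ω, inner ℝ (hG.approxBounded b j ω) (Y ω) ∂P)
      Filter.atTop (nhds (∫ ω, inner ℝ (G ω) (Y ω) ∂P)) :=
    tendsto_integral_of_dominated_convergence (fun _ => b * B)
      (fun j => (hii _).aestronglyMeasurable) (integrable_const _)
      (fun j => ae_of_all _ fun ω => (norm_inner_le_norm _ _).trans
        (mul_le_mul (happ j ω) (hYB ω) (norm_nonneg _) hGb0))
      (ae_of_all _ fun ω => (hlim ω).inner tendsto_const_nhds)
  have l2 : Filter.Tendsto (fun j => ∫ ω, ‖hG.approxBounded b j ω‖ ∂P)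
      Filter.atTop (nhds (∫ ω, ‖G ω‖ ∂P)) :=
    tendsto_integral_of_dominated_convergence (fun _ => b)
      (fun j => (hni _).aestronglyMeasurable) (integrable_const _)
      (fun j => ae_of_all _ fun ω => by simpa using happ j ω)
      (ae_of_all _ fun ω => (hlim ω).norm)
  exact le_of_tendsto_of_tendsto' l1 (l2.const_mul κ) fun j => hsimple _

variable {Ω : Type*} [mΩ : MeasurableSpace Ω] {P : Measure Ω}
  {X : Type*} [PseudoMetricSpace X] [MeasurableSpace X] {Z : ℕ → Ω → X × ℝ}
  {V : Type*} [NormedAddCommGroup V] [InnerProductSpace ℝ V]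

/-- The mixing coefficient bounds the conditional bias of each test function. -/
theorem ae_abs_condExp_sub_le {φ : X × ℝ → ℝ} (hφ : φ ∈ lipTest X) {k : ℕ} {t : ℝ} (ht : 0 ≤ t)
    (hτ : tauCoeff P Z k ≤ ENNReal.ofReal t) (i : ℕ) :
    ∀ᵐ ω ∂P, |(P[fun ω' => φ (Z (i + k) ω') | past Z i]) ω - ∫ ω', φ (Z (i + k) ω') ∂P| ≤ t := by
  have h : eLpNorm (fun ω => (P[fun ω' => φ (Z (i + k) ω') | past Z i]) ω
      - ∫ ω', φ (Z (i + k) ω') ∂P) ∞ P ≤ ENNReal.ofReal t := by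
    refine le_trans ?_ hτ
    unfold tauCoeff
    refine le_trans ?_ (le_iSup₂ φ hφ)
    exact le_iSup (fun i : ℕ => eLpNorm (fun ω => (P[fun ω' => φ (Z (i + k) ω') | past Z i]) ω
      - ∫ ω', φ (Z (i + k) ω') ∂P) ∞ P) i
  rw [eLpNorm_exponent_top] at h
  filter_upwards [ae_le_eLpNormEssSup (μ := P) (f := fun ω =>
    (P[fun ω' => φ (Z (i + k) ω') | past Z i]) ω - ∫ ω', φ (Z (i + k) ω') ∂P)] with ω hω
  have := hω.trans h
  rwa [← ofReal_norm, ENNReal.ofReal_le_ofReal_iff ht, Real.norm_eq_abs] at this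

variable [IsProbabilityMeasure P]

/-- Decoupling of a bounded Lipschitz function of `Z (i + k)` from a weight depending on
`Z 0, …, Z i`. -/
theorem abs_integral_mul_sub_le (hZ : ∀ j, Measurable (Z j)) {φ : X × ℝ → ℝ}
    (hφm : Measurable φ) {B L : ℝ} (hL : 0 < L) (hB : ∀ z, |φ z| ≤ B)
    (hφ : ∀ z w, |φ z - φ w| ≤ L * (dist z.1 w.1 + |z.2 - w.2|)) {k : ℕ} {t : ℝ} (ht : 0 ≤ t)
    (hτ : tauCoeff P Z k ≤ ENNReal.ofReal t) (i : ℕ) {g : Ω → ℝ}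
    (hg : StronglyMeasurable[past Z i] g) (hg0 : ∀ ω, 0 ≤ g ω) {G : ℝ} (hgG : ∀ ω, g ω ≤ G) :
    |∫ ω, g ω * φ (Z (i + k) ω) ∂P - (∫ ω, g ω ∂P) * ∫ ω, φ (Z (i + k) ω) ∂P|
      ≤ L * t * ∫ ω, g ω ∂P := by
  have hm := past_le hZ i
  set ψ : X × ℝ → ℝ := fun z => L⁻¹ * φ z with hψ
  have hψt : ψ ∈ lipTest X := by
    refine ⟨⟨L⁻¹ * B, fun z => ?_⟩, fun z w => ?_⟩
    · rw [hψ, abs_mul, abs_of_pos (inv_pos.2 hL)]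
      have := hB z
      gcongr
    · rw [hψ, ← mul_sub, abs_mul, abs_of_pos (inv_pos.2 hL), inv_mul_le_iff₀ hL]
      exact hφ z w
  set f : Ω → ℝ := fun ω => ψ (Z (i + k) ω) with hf
  have hfm : Measurable f := (hφm.const_mul L⁻¹).comp (hZ _)
  have hfi : Integrable f P := by
    refine Integrable.of_bound hfm.aestronglyMeasurable (L⁻¹ * B) (ae_of_all _ fun ω => ?_)
    rw [Real.norm_eq_abs, hf, hψ, abs_mul, abs_of_pos (inv_pos.2 hL)]
    have := hB (Z (i + k) ω)
    gcongr
  have hgs : StronglyMeasurable g := hg.mono hm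
  have hgb : ∀ ω, ‖g ω‖ ≤ G := fun ω => by rw [Real.norm_of_nonneg (hg0 ω)]; exact hgG ω
  have hgi : Integrable g P := Integrable.of_bound hgs.aestronglyMeasurable G (ae_of_all _ hgb)
  have hgf : Integrable (g * f) P := hfi.bdd_mul hgs.aestronglyMeasurable (ae_of_all _ hgb)
  have hpull := condExp_mul_of_stronglyMeasurable_left hg hgf hfi
  have e1 : ∫ ω, g ω * f ω ∂P = ∫ ω, g ω * (P[f | past Z i]) ω ∂P := by
    rw [← integral_condExp hm (f := fun ω => g ω * f ω)]
    exact integral_congr_ae hpull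
  have hci : Integrable (fun ω => g ω * (P[f | past Z i]) ω) P :=
    integrable_condExp.bdd_mul hgs.aestronglyMeasurable (ae_of_all _ hgb)
  have e2 : ∫ ω, g ω * f ω ∂P - (∫ ω, g ω ∂P) * ∫ ω, f ω ∂P
      = ∫ ω, g ω * ((P[f | past Z i]) ω - ∫ ω', f ω' ∂P) ∂P := by
    rw [e1, ← integral_mul_const, ← integral_sub hci (hgi.mul_const _)]
    simp only [mul_sub]
  have e3 : |∫ ω, g ω * f ω ∂P - (∫ ω, g ω ∂P) * ∫ ω, f ω ∂P| ≤ t * ∫ ω, g ω ∂P := by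
    rw [e2, ← Real.norm_eq_abs, ← integral_const_mul]
    refine norm_integral_le_of_norm_le (hgi.const_mul t) ?_
    filter_upwards [ae_abs_condExp_sub_le hψt ht hτ i] with ω hω
    rw [norm_mul, Real.norm_of_nonneg (hg0 ω), Real.norm_eq_abs, mul_comm]
    exact mul_le_mul_of_nonneg_right hω (hg0 ω)
  have hφf : ∀ ω, φ (Z (i + k) ω) = L * f ω := fun ω => by
    simp only [hf, hψ]; rw [mul_inv_cancel_left₀ hL.ne']
  simp only [hφf, mul_left_comm _ L, integral_const_mul]
  rw [← mul_sub, abs_mul, abs_of_pos hL, mul_assoc]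
  gcongr

/-- Decoupling of a centred bounded Lipschitz vector from a vector depending on `Z 0, …, Z i`. -/
theorem integral_inner_le (hZ : ∀ j, Measurable (Z j)) {F : X × ℝ → V}
    (hFm : StronglyMeasurable F) {B L : ℝ} (hL : 0 < L) (hB : ∀ z, ‖F z‖ ≤ B)
    (hF : ∀ z w, ‖F z - F w‖ ≤ L * (dist z.1 w.1 + |z.2 - w.2|)) {k : ℕ} {t : ℝ} (ht : 0 ≤ t)
    (hτ : tauCoeff P Z k ≤ ENNReal.ofReal t) (i : ℕ)
    (h0 : ∀ v : V, ∫ ω, inner ℝ v (F (Z (i + k) ω)) ∂P = 0) {G : Ω → V}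
    (hG : StronglyMeasurable[past Z i] G) {b : ℝ} (hGb : ∀ ω, ‖G ω‖ ≤ b) :
    ∫ ω, inner ℝ (G ω) (F (Z (i + k) ω)) ∂P ≤ L * t * ∫ ω, ‖G ω‖ ∂P := by
  have hm := past_le hZ i
  refine integral_inner_le_of_forall_setIntegral hm (hFm.comp_measurable (hZ _))
    (fun ω => hB _) (fun v s hs => ?_) hG hGb
  rcases eq_or_ne v 0 with rfl | hv
  · simp
  have hv0 : 0 < ‖v‖ := norm_pos_iff.2 hv
  have key := abs_integral_mul_sub_le (φ := fun z => inner ℝ v (F z)) (B := ‖v‖ * B)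
    (L := ‖v‖ * L) hZ (stronglyMeasurable_const.inner hFm).measurable (by positivity)
    (fun z => (abs_real_inner_le_norm _ _).trans (by gcongr; exact hB z))
    (fun z w => by
      rw [← inner_sub_right, mul_assoc]
      exact (abs_real_inner_le_norm _ _).trans (by gcongr; exact hF z w))
    ht hτ i (g := s.indicator fun _ => (1 : ℝ))
    (stronglyMeasurable_const.indicator hs)
    (fun ω => Set.indicator_nonneg (fun _ _ => zero_le_one) ω) (G := 1)
    (fun ω => Set.indicator_le_self' (fun _ _ => zero_le_one) ω)
  rw [h0 v, mul_zero, sub_zero, integral_indicator (hm s hs), setIntegral_const, smul_eq_mul,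
    mul_one] at key
  have e : ∫ ω in s, inner ℝ v (F (Z (i + k) ω)) ∂P
      = ∫ ω, s.indicator (fun _ => (1 : ℝ)) ω * inner ℝ v (F (Z (i + k) ω)) ∂P := by
    rw [← integral_indicator (hm s hs)]
    congr 1 with ω
    by_cases hω : ω ∈ s <;> simp [hω]
  simp only [Function.comp_apply]
  rw [e]
  calc _ ≤ _ := le_abs_self _
    _ ≤ _ := key
    _ = _ := by ring

end Decoupling

/-! ### Bernstein's inequality for `τ`-mixing averages -/

section Bernstein

theorem integrable_cosh_norm {Ω V : Type*} [MeasurableSpace Ω] [NormedAddCommGroup V] {P : Measure Ω}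
    [IsFiniteMeasure P] {Y : Ω → V} (hY : StronglyMeasurable Y) {B : ℝ}
    (hB : ∀ ω, ‖Y ω‖ ≤ B) : Integrable (fun ω => Real.cosh ‖Y ω‖) P := by
  refine Integrable.of_bound
    (Real.continuous_cosh.comp_stronglyMeasurable hY.norm).aestronglyMeasurable (Real.cosh B)
    (ae_of_all _ fun ω => ?_)
  rw [Real.norm_of_nonneg (Real.cosh_pos _).le, Real.cosh_le_cosh, abs_of_nonneg (norm_nonneg _)]
  exact (hB ω).trans (le_abs_self B)

theorem stronglyMeasurable_coshGrad {Ω V : Type*} [NormedAddCommGroup V] [InnerProductSpace ℝ V]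
    {m : MeasurableSpace Ω} {W : Ω → V}
    (hW : StronglyMeasurable[m] W) : StronglyMeasurable[m] fun ω => coshGrad (W ω) := by
  have h1 : Measurable[m] fun ω => Real.sinh ‖W ω‖ / ‖W ω‖ :=
    (Real.measurable_sinh.comp hW.norm.measurable).div hW.norm.measurable
  exact h1.stronglyMeasurable.smul hW

variable {Ω : Type*} [mΩ : MeasurableSpace Ω] {P : Measure Ω} [IsProbabilityMeasure P]
  {X : Type*} [PseudoMetricSpace X] [MeasurableSpace X] {Z : ℕ → Ω → X × ℝ}
  {V : Type*} [NormedAddCommGroup V] [InnerProductSpace ℝ V]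

/-- Appending to a sum of past variables a centred variable at distance `k` in time. -/
theorem integral_cosh_norm_add_le (hZ : ∀ j, Measurable (Z j)) {F : X × ℝ → V}
    (hFm : StronglyMeasurable F) {L : ℝ} (hL : 0 < L) (hB : ∀ z, ‖F z‖ ≤ 1)
    (hF : ∀ z w, ‖F z - F w‖ ≤ L * (dist z.1 w.1 + |z.2 - w.2|)) {k : ℕ} {t : ℝ} (ht : 0 ≤ t)
    (hτ : tauCoeff P Z k ≤ ENNReal.ofReal t) (i : ℕ)
    (h0 : ∀ v : V, ∫ ω, inner ℝ v (F (Z (i + k) ω)) ∂P = 0) {s : ℝ}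
    (hs : ∫ ω, ‖F (Z (i + k) ω)‖ ^ 2 ∂P ≤ s) {W : Ω → V}
    (hW : StronglyMeasurable[past Z i] W) {b : ℝ} (hWb : ∀ ω, ‖W ω‖ ≤ b) :
    ∫ ω, Real.cosh ‖W ω + F (Z (i + k) ω)‖ ∂P
      ≤ (1 + (s + 3 * L * t)) * ∫ ω, Real.cosh ‖W ω‖ ∂P := by
  have hm := past_le hZ i
  have hWs : StronglyMeasurable W := hW.mono hm
  have hFZ : StronglyMeasurable fun ω => F (Z (i + k) ω) := hFm.comp_measurable (hZ _)
  have hcb : ∀ ω, Real.cosh ‖W ω‖ ≤ Real.cosh b := fun ω => by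
    rw [Real.cosh_le_cosh, abs_of_nonneg (norm_nonneg _)]
    exact (hWb ω).trans (le_abs_self b)
  have hcm : StronglyMeasurable[past Z i] fun ω => Real.cosh ‖W ω‖ :=
    Real.continuous_cosh.comp_stronglyMeasurable hW.norm
  have hgm := stronglyMeasurable_coshGrad hW
  have hgb : ∀ ω, ‖coshGrad (W ω)‖ ≤ Real.cosh b := fun ω => (norm_coshGrad_le _).trans (hcb ω)
  have i1 : Integrable (fun ω => Real.cosh ‖W ω‖) P := integrable_cosh_norm hWs hWb
  have i2 : Integrable (fun ω => Real.cosh ‖W ω‖ * ‖F (Z (i + k) ω)‖ ^ 2) P := by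
    refine Integrable.of_bound ((hcm.mono hm).mul (hFZ.norm.pow 2)).aestronglyMeasurable
      (Real.cosh b * 1) (ae_of_all _ fun ω => ?_)
    have := Real.cosh_pos ‖W ω‖
    rw [Real.norm_of_nonneg (by positivity)]
    exact mul_le_mul (hcb ω) (pow_le_one₀ (norm_nonneg _) (hB _)) (by positivity)
      (Real.cosh_pos _).le
  have i3 : Integrable (fun ω => (inner ℝ (coshGrad (W ω)) (F (Z (i + k) ω)) : ℝ)) P := by
    refine Integrable.of_bound ((hgm.mono hm).inner hFZ).aestronglyMeasurable
      (Real.cosh b * 1) (ae_of_all _ fun ω => ?_)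
    exact (norm_inner_le_norm _ _).trans
      (mul_le_mul (hgb ω) (hB _) (norm_nonneg _) (Real.cosh_pos _).le)
  have i4 : Integrable (fun ω => ‖coshGrad (W ω)‖) P :=
    Integrable.of_bound (hgm.mono hm).norm.aestronglyMeasurable _
      (ae_of_all _ fun ω => by simpa using hgb ω)
  -- the second moment, conditionally on the past
  have k1 := abs_integral_mul_sub_le (φ := fun z => ‖F z‖ ^ 2) (B := 1) (L := 2 * L) hZ
    (hFm.norm.pow 2).measurable (by positivity)
    (fun z => by
      rw [abs_of_nonneg (by positivity)]
      exact pow_le_one₀ (norm_nonneg _) (hB _))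
    (fun z w => by
      have e : ‖F z‖ ^ 2 - ‖F w‖ ^ 2 = (‖F z‖ + ‖F w‖) * (‖F z‖ - ‖F w‖) := by ring
      rw [e, abs_mul, abs_of_nonneg (by positivity), mul_assoc]
      have h1 := hB z
      have h2 := hB w
      gcongr
      · linarith
      · exact (abs_norm_sub_norm_le _ _).trans (hF z w))
    ht hτ i hcm (fun ω => (Real.cosh_pos _).le) hcb
  -- the first moment, conditionally on the past
  have k2 := integral_inner_le hZ hFm hL hB hF ht hτ i h0 hgm hgb
  have k3 : ∫ ω, ‖coshGrad (W ω)‖ ∂P ≤ ∫ ω, Real.cosh ‖W ω‖ ∂P :=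
    integral_mono i4 i1 fun ω => norm_coshGrad_le _
  have hpos : 0 ≤ ∫ ω, Real.cosh ‖W ω‖ ∂P := integral_nonneg fun ω => (Real.cosh_pos _).le
  have hle : ∫ ω, Real.cosh ‖W ω + F (Z (i + k) ω)‖ ∂P
      ≤ ∫ ω, (Real.cosh ‖W ω‖ + Real.cosh ‖W ω‖ * ‖F (Z (i + k) ω)‖ ^ 2
        + inner ℝ (coshGrad (W ω)) (F (Z (i + k) ω))) ∂P := by
    refine integral_mono (integrable_cosh_norm (hWs.add hFZ) (B := b + 1) fun ω =>
      (norm_add_le _ _).trans (add_le_add (hWb ω) (hB _))) ((i1.add i2).add i3) fun ω => ?_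
    have := cosh_norm_add_le (W ω) _ (hB (Z (i + k) ω))
    simp only
    linarith
  have i5 : Integrable (fun ω => Real.cosh ‖W ω‖ + Real.cosh ‖W ω‖ * ‖F (Z (i + k) ω)‖ ^ 2) P :=
    i1.add i2
  rw [integral_add i5 i3, integral_add i1 i2] at hle
  have k1' := (abs_le.1 k1).2
  have k4 := mul_le_mul_of_nonneg_left hs hpos
  have k5 := mul_le_mul_of_nonneg_left k3 (by positivity : 0 ≤ L * t)
  nlinarith

/-- Exponential moment of the sum over a residue class of times modulo `k`: any two of its times
are at least `k` apart. -/
theorem integral_cosh_norm_residueClass_le (hZ : ∀ j, Measurable (Z j)) {F : X × ℝ → V}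
    (hFm : StronglyMeasurable F) {L : ℝ} (hL : 0 < L) (hB : ∀ z, ‖F z‖ ≤ 1)
    (hF : ∀ z w, ‖F z - F w‖ ≤ L * (dist z.1 w.1 + |z.2 - w.2|)) {k : ℕ} {t : ℝ} (ht : 0 ≤ t)
    (hτ : tauCoeff P Z k ≤ ENNReal.ofReal t)
    (h0 : ∀ j, ∀ v : V, ∫ ω, inner ℝ v (F (Z j ω)) ∂P = 0) {s : ℝ}
    (hs : ∀ j, ∫ ω, ‖F (Z j ω)‖ ^ 2 ∂P ≤ s) (i N : ℕ) :
    ∫ ω, Real.cosh ‖∑ j ∈ (Finset.range N).filter (fun j => j % k = i), F (Z j ω)‖ ∂P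
      ≤ (1 + (s + 3 * L * t)) ^ ((Finset.range N).filter (fun j => j % k = i)).card := by
  have hs0 : 0 ≤ s := le_trans (integral_nonneg fun ω => by positivity) (hs 0)
  have ha : 0 ≤ 3 * L * t := by positivity
  induction N with
  | zero => simp
  | succ N ih =>
    rw [Finset.range_add_one, Finset.filter_insert]
    by_cases hN : N % k = i
    · have hnm : N ∉ (Finset.range N).filter (fun j => j % k = i) := by simp
      rw [if_pos hN, Finset.card_insert_of_notMem hnm]
      simp only [Finset.sum_insert hnm]
      rcases lt_or_ge N k with hlt | hge
      · have hemp : (Finset.range N).filter (fun j => j % k = i) = ∅ := by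
          refine Finset.filter_eq_empty_iff.2 fun j hj => ?_
          rw [Finset.mem_range] at hj
          rw [Nat.mod_eq_of_lt (hj.trans hlt), ← hN, Nat.mod_eq_of_lt hlt]
          exact hj.ne
        rw [hemp]
        simp only [Finset.sum_empty, add_zero, Finset.card_empty, zero_add, pow_one]
        have hFZ : StronglyMeasurable fun ω => F (Z N ω) := hFm.comp_measurable (hZ _)
        have i2 : Integrable (fun ω => ‖F (Z N ω)‖ ^ 2) P :=
          Integrable.of_bound (hFZ.norm.pow 2).aestronglyMeasurable 1 (ae_of_all _ fun ω => by
            rw [Real.norm_of_nonneg (by positivity)]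
            exact pow_le_one₀ (norm_nonneg _) (hB _))
        calc ∫ ω, Real.cosh ‖F (Z N ω)‖ ∂P ≤ ∫ ω, (1 + ‖F (Z N ω)‖ ^ 2) ∂P := by
              refine integral_mono (integrable_cosh_norm hFZ fun ω => hB _)
                ((integrable_const _).add i2) fun ω => ?_
              simpa [coshGrad] using cosh_norm_add_le 0 _ (hB (Z N ω))
          _ = 1 + ∫ ω, ‖F (Z N ω)‖ ^ 2 ∂P := by
              rw [integral_add (integrable_const _) i2]; simp
          _ ≤ _ := by linarith [hs N]
      · have hmem : ∀ j ∈ (Finset.range N).filter (fun j => j % k = i), j ≤ N - k := by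
          intro j hj
          rw [Finset.mem_filter, Finset.mem_range] at hj
          have hdvd : k ∣ N - j := Nat.dvd_of_mod_eq_zero
            (Nat.sub_mod_eq_zero_of_mod_eq (hN.trans hj.2.symm))
          have := Nat.le_of_dvd (by omega) hdvd
          omega
        have hW : StronglyMeasurable[past Z (N - k)] fun ω =>
            ∑ j ∈ (Finset.range N).filter (fun j => j % k = i), F (Z j ω) :=
          Finset.stronglyMeasurable_fun_sum _ fun j hj =>
            hFm.comp_measurable (measurable_past (hmem j hj))
        have hNk : N - k + k = N := Nat.sub_add_cancel hge
        have key := integral_cosh_norm_add_le (s := s) hZ hFm hL hB hF ht hτ (N - k)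
          (by rw [hNk]; exact h0 N) (by rw [hNk]; exact hs N) hW
          (b := ((Finset.range N).filter (fun j => j % k = i)).card) (fun ω => by
            refine (norm_sum_le _ _).trans ((Finset.sum_le_sum fun j _ => hB _).trans ?_)
            simp)
        rw [hNk] at key
        simp only [add_comm (F _)]
        rw [pow_succ']
        refine key.trans ?_
        gcongr
    · rw [if_neg hN]
      exact ih

/-- Each residue class modulo `k` has at least `ℓ` elements below `n` if `k * ℓ ≤ n`. -/
theorem le_card_residueClass {n k ℓ i : ℕ} (hk : k * ℓ ≤ n) (hi : i < k) :
    ℓ ≤ ((Finset.range n).filter (fun j => j % k = i)).card := by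
  have hsub : (Finset.range ℓ).image (fun j => i + k * j) ⊆
      (Finset.range n).filter (fun j => j % k = i) := by
    intro x hx
    obtain ⟨j, hj, rfl⟩ := Finset.mem_image.1 hx
    rw [Finset.mem_range] at hj
    rw [Finset.mem_filter, Finset.mem_range]
    refine ⟨?_, by rw [Nat.add_mul_mod_self_left, Nat.mod_eq_of_lt hi]⟩
    calc i + k * j < k + k * j := by omega
      _ = k * (j + 1) := by ring
      _ ≤ k * ℓ := Nat.mul_le_mul_left _ hj
      _ ≤ n := hk
  have hinj : Function.Injective fun j => i + k * j := fun a b hab =>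
    Nat.eq_of_mul_eq_mul_left (Nat.zero_lt_of_lt hi) (Nat.add_left_cancel hab)
  have := Finset.card_le_card hsub
  rwa [Finset.card_image_of_injective _ hinj, Finset.card_range] at this

/-- Exponential moment of the norm of an average. The times are split into `k = ⌊n / ℓ⌋` residue
classes, each of at least `ℓ` elements, and the average of all terms is a convex combination of
the averages over the classes. -/
theorem integral_exp_norm_average_le (hZ : ∀ j, Measurable (Z j)) {F : X × ℝ → V}
    (hFm : StronglyMeasurable F) {c L : ℝ} (hL : 0 < L) (hB : ∀ z, ‖F z‖ ≤ c)
    (hF : ∀ z w, ‖F z - F w‖ ≤ L * (dist z.1 w.1 + |z.2 - w.2|)) {n ℓ : ℕ} (hℓ : 1 ≤ ℓ)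
    (hℓn : ℓ ≤ n) {t : ℝ} (ht : 0 ≤ t) (hτ : tauCoeff P Z (n / ℓ) ≤ ENNReal.ofReal t)
    (h0 : ∀ j, ∀ v : V, ∫ ω, inner ℝ v (F (Z j ω)) ∂P = 0) {s : ℝ}
    (hs : ∀ j, ∫ ω, ‖F (Z j ω)‖ ^ 2 ∂P ≤ s) {u : ℝ} (hu : 0 < u) (huc : u * c ≤ ℓ) :
    ∫ ω, Real.exp (u * ‖(n : ℝ)⁻¹ • ∑ j ∈ Finset.range n, F (Z j ω)‖) ∂P
      ≤ 2 * Real.exp (u ^ 2 * s / ℓ + 3 * u * (L * t)) := by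
  set k := n / ℓ with hk
  have hk1 : 1 ≤ k := (Nat.one_le_div_iff (by omega)).2 hℓn
  have hkl : k * ℓ ≤ n := Nat.div_mul_le_self n ℓ
  have hn0 : (0 : ℝ) < n := by exact_mod_cast (by omega : 0 < n)
  have hℓ0 : (0 : ℝ) < ℓ := by exact_mod_cast hℓ
  have hs0 : 0 ≤ s := le_trans (integral_nonneg fun ω => by positivity) (hs 0)
  have hFZ : ∀ j, StronglyMeasurable fun ω => F (Z j ω) := fun j => hFm.comp_measurable (hZ _)
  set I : ℕ → Finset ℕ := fun i => (Finset.range n).filter (fun j => j % k = i) with hI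
  set m : ℕ → ℝ := fun i => ((I i).card : ℝ) with hm
  have hmℓ : ∀ i ∈ Finset.range k, (ℓ : ℝ) ≤ m i := fun i hi =>
    Nat.cast_le.2 (le_card_residueClass hkl (Finset.mem_range.1 hi))
  have hmaps : ∀ j ∈ Finset.range n, j % k ∈ Finset.range k := fun j _ =>
    Finset.mem_range.2 (Nat.mod_lt _ hk1)
  have hmsum : ∑ i ∈ Finset.range k, m i / n = 1 := by
    rw [← Finset.sum_div, hm, ← Nat.cast_sum, ← Finset.card_eq_sum_card_fiberwise hmaps,
      Finset.card_range, div_self hn0.ne']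
  set W : ℕ → Ω → V := fun i ω => ∑ j ∈ I i, (u / m i) • F (Z j ω) with hW
  have hWm : ∀ i, StronglyMeasurable (W i) := fun i =>
    Finset.stronglyMeasurable_fun_sum _ fun j _ => (hFZ j).const_smul _
  have hWi : ∀ i ∈ Finset.range k, ∀ ω, ‖W i ω‖ ≤ m i := by
    intro i hi ω
    have hmi := hℓ0.trans_le (hmℓ i hi)
    refine (norm_sum_le _ _).trans ((Finset.sum_le_sum fun j _ => ?_).trans_eq
      (by rw [Finset.sum_const, nsmul_one]))
    rw [norm_smul, Real.norm_of_nonneg (by positivity), div_mul_eq_mul_div, div_le_one hmi]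
    calc u * ‖F (Z j ω)‖ ≤ u * c := by gcongr; exact hB _
      _ ≤ ℓ := huc
      _ ≤ m i := hmℓ i hi
  have hmoment : ∀ i ∈ Finset.range k, ∫ ω, Real.cosh ‖W i ω‖ ∂P
      ≤ Real.exp (u ^ 2 * s / ℓ + 3 * u * (L * t)) := by
    intro i hi
    have hmi := hℓ0.trans_le (hmℓ i hi)
    have hv : 0 < u / m i := by positivity
    have key := integral_cosh_norm_residueClass_le (F := fun z => (u / m i) • F z)
      (L := u / m i * L) (s := (u / m i) ^ 2 * s) hZ (hFm.const_smul _) (by positivity)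
      (fun z => by
        rw [norm_smul, Real.norm_of_nonneg hv.le, div_mul_eq_mul_div, div_le_one hmi]
        calc u * ‖F z‖ ≤ u * c := by gcongr; exact hB _
          _ ≤ ℓ := huc
          _ ≤ m i := hmℓ i hi)
      (fun z w => by
        rw [← smul_sub, norm_smul, Real.norm_of_nonneg hv.le, mul_assoc]
        gcongr
        exact hF z w) ht hτ
      (fun j v => by simp only [inner_smul_right, integral_const_mul, h0, mul_zero])
      (fun j => by
        simp only [norm_smul, mul_pow, Real.norm_of_nonneg hv.le, integral_const_mul]
        gcongr
        exact hs j) i n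
    refine key.trans ?_
    have h1 : 1 + ((u / m i) ^ 2 * s + 3 * (u / m i * L) * t)
        ≤ Real.exp ((u / m i) ^ 2 * s + 3 * (u / m i * L) * t) := by
      rw [add_comm]; exact Real.add_one_le_exp _
    refine (pow_le_pow_left₀ (by positivity) h1 _).trans ?_
    rw [← Real.exp_nat_mul, Real.exp_le_exp]
    have e : ((Finset.filter (fun j => j % k = i) (Finset.range n)).card : ℝ)
        * ((u / m i) ^ 2 * s + 3 * (u / m i * L) * t)
        = u ^ 2 * s / m i + 3 * u * (L * t) := by
      change m i * _ = _
      field_simp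
    rw [e]
    gcongr
    exact hmℓ i hi
  have hpt : ∀ ω, Real.exp (u * ‖(n : ℝ)⁻¹ • ∑ j ∈ Finset.range n, F (Z j ω)‖)
      ≤ ∑ i ∈ Finset.range k, m i / n * (2 * Real.cosh ‖W i ω‖) := by
    intro ω
    have hdec : (u * (n : ℝ)⁻¹) • ∑ j ∈ Finset.range n, F (Z j ω)
        = ∑ i ∈ Finset.range k, (m i / n) • W i ω := by
      rw [← Finset.sum_fiberwise_of_maps_to hmaps, Finset.smul_sum]
      refine Finset.sum_congr rfl fun i hi => ?_
      have hmi := hℓ0.trans_le (hmℓ i hi)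
      rw [hW]
      simp only
      rw [← Finset.smul_sum, smul_smul]
      congr 1
      field_simp
    have hle : u * ‖(n : ℝ)⁻¹ • ∑ j ∈ Finset.range n, F (Z j ω)‖
        ≤ ∑ i ∈ Finset.range k, m i / n * ‖W i ω‖ := by
      calc u * ‖(n : ℝ)⁻¹ • ∑ j ∈ Finset.range n, F (Z j ω)‖
          = ‖(u * (n : ℝ)⁻¹) • ∑ j ∈ Finset.range n, F (Z j ω)‖ := by
            rw [mul_smul, norm_smul u, Real.norm_of_nonneg hu.le]
        _ ≤ ∑ i ∈ Finset.range k, ‖(m i / n) • W i ω‖ := by rw [hdec]; exact norm_sum_le _ _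
        _ = _ := Finset.sum_congr rfl fun i hi => by
            have hmi := hℓ0.trans_le (hmℓ i hi)
            rw [norm_smul, Real.norm_of_nonneg (by positivity)]
    refine (Real.exp_le_exp.2 hle).trans ?_
    have hconv := convexOn_exp.map_sum_le (t := Finset.range k) (w := fun i => m i / n)
      (p := fun i => ‖W i ω‖) (fun i hi => by positivity) hmsum (fun _ _ => Set.mem_univ _)
    simp only [smul_eq_mul] at hconv
    refine hconv.trans (Finset.sum_le_sum fun i _ => ?_)
    gcongr
    rw [Real.cosh_eq]
    linarith [Real.exp_pos (-‖W i ω‖)]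
  have hint : ∀ i ∈ Finset.range k,
      Integrable (fun ω => m i / n * (2 * Real.cosh ‖W i ω‖)) P := fun i hi =>
    ((integrable_cosh_norm (hWm i) (hWi i hi)).const_mul 2).const_mul _
  refine (integral_mono_of_nonneg (ae_of_all _ fun ω => (Real.exp_pos _).le)
    (integrable_finsetSum _ hint) (ae_of_all _ hpt)).trans ?_
  rw [integral_finsetSum _ hint]
  simp only [integral_const_mul]
  calc ∑ i ∈ Finset.range k, m i / n * (2 * ∫ ω, Real.cosh ‖W i ω‖ ∂P)
      ≤ ∑ i ∈ Finset.range k, m i / n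
          * (2 * Real.exp (u ^ 2 * s / ℓ + 3 * u * (L * t))) := by
        refine Finset.sum_le_sum fun i hi => ?_
        have := hmoment i hi
        gcongr
    _ = _ := by rw [← Finset.sum_mul, hmsum, one_mul]

/-- Bernstein's inequality for averages of bounded Lipschitz vectors along a `τ`-mixing process.
The effective sample size `ℓ` is admissible if it is `1` or if the mixing coefficient at distance
`⌊n / ℓ⌋` is of the order of the bound. -/
theorem prob_norm_average_le (hZ : ∀ j, Measurable (Z j)) {F : X × ℝ → V}
    (hFm : StronglyMeasurable F) {c L : ℝ} (hc : 0 < c) (hL : 0 < L) (hB : ∀ z, ‖F z‖ ≤ c)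
    (hF : ∀ z w, ‖F z - F w‖ ≤ L * (dist z.1 w.1 + |z.2 - w.2|)) {n ℓ : ℕ} (hℓ : 1 ≤ ℓ)
    (hℓn : ℓ ≤ n) {σ : ℝ} {t : ℝ} (hτ : tauCoeff P Z (n / ℓ) ≤ ENNReal.ofReal t)
    (hδ : ℓ = 1 ∨ L * t ≤ max (c / (ℓ : ℝ)) (σ / √(ℓ : ℝ)))
    (h0 : ∀ j, ∀ v : V, ∫ ω, inner ℝ v (F (Z j ω)) ∂P = 0)
    (hs : ∀ j, ∫ ω, ‖F (Z j ω)‖ ^ 2 ∂P ≤ σ ^ 2) (hσ : 0 ≤ σ) {η : ℝ} (hη : 0 < η)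
    (hη' : η ≤ 1 / 2) :
    ENNReal.ofReal (1 - η) ≤ P {ω | ‖(n : ℝ)⁻¹ • ∑ j ∈ Finset.range n, F (Z j ω)‖
      ≤ 4 * Real.log (2 * η⁻¹) * max (c / (ℓ : ℝ)) (σ / √(ℓ : ℝ))} := by
  have hn0 : (0 : ℝ) < n := by exact_mod_cast (by omega : 0 < n)
  have hℓ0 : (0 : ℝ) < ℓ := by exact_mod_cast hℓ
  -- `B ≥ log 4 ≥ 4 / 3`, which absorbs the additive constant in `B + 4 ≤ 4 B` below
  set B := Real.log (2 * η⁻¹) with hBdef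
  set M := max (c / (ℓ : ℝ)) (σ / √(ℓ : ℝ)) with hM
  have hM0 : 0 < M := lt_max_of_lt_left (by positivity)
  have hB43 : 4 / 3 ≤ B := by
    have h4 : (4 : ℝ) ≤ 2 * η⁻¹ := by
      have : (2 : ℝ) ≤ η⁻¹ := by rw [le_inv_comm₀ (by norm_num) hη]; linarith
      linarith
    have h5 : Real.log 4 = 2 * Real.log 2 := by
      rw [show (4 : ℝ) = 2 ^ 2 by norm_num, Real.log_pow]; norm_num
    have := Real.log_le_log (by norm_num) h4
    linarith [Real.log_two_gt_d9]
  have havg : ∀ ω, ‖(n : ℝ)⁻¹ • ∑ j ∈ Finset.range n, F (Z j ω)‖ ≤ c := fun ω => by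
    rw [norm_smul, norm_inv, Real.norm_of_nonneg hn0.le, inv_mul_le_iff₀ hn0]
    refine (norm_sum_le _ _).trans ((Finset.sum_le_sum fun j _ => hB _).trans ?_)
    simp
  -- for `ℓ = 1` the bound exceeds the trivial bound `c` of the average
  by_cases hℓ1 : ℓ = 1
  · have hall : {ω | ‖(n : ℝ)⁻¹ • ∑ j ∈ Finset.range n, F (Z j ω)‖ ≤ 4 * B * M} = Set.univ := by
      refine Set.eq_univ_of_forall fun ω => (havg ω).trans ?_
      have : c ≤ M := by rw [hM, hℓ1]; simp
      nlinarith
    rw [hall, measure_univ, ENNReal.ofReal_le_one]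
    linarith
  -- `t` may be negative, in which case the mixing coefficient vanishes
  have hδ' : L * max t 0 ≤ M := by
    rcases max_cases t 0 with h | h
    · rw [h.1]; exact hδ.resolve_left hℓ1
    · rw [h.1, mul_zero]; exact hM0.le
  have hτ' : tauCoeff P Z (n / ℓ) ≤ ENNReal.ofReal (max t 0) :=
    hτ.trans (ENNReal.ofReal_le_ofReal (le_max_left _ _))
  -- the Chernoff bound with parameter `M⁻¹`, for which the exponent of the moment is at most `4`
  have hu : 0 < M⁻¹ := inv_pos.2 hM0
  have hmgf := integral_exp_norm_average_le hZ hFm hL hB hF hℓ hℓn (le_max_right t 0) hτ' h0 hs hu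
    (by rw [inv_mul_le_iff₀ hM0]; exact (div_le_iff₀ hℓ0).1 (le_max_left _ _))
  have hexp : M⁻¹ ^ 2 * σ ^ 2 / ℓ + 3 * M⁻¹ * (L * max t 0) ≤ 4 := by
    have h1 : M⁻¹ ^ 2 * σ ^ 2 / ℓ ≤ 1 := by
      have : (σ / √(ℓ : ℝ)) ^ 2 ≤ M ^ 2 := by
        gcongr
        exact le_max_right _ _
      rw [div_pow, Real.sq_sqrt hℓ0.le] at this
      rw [mul_div_assoc, inv_pow, inv_mul_le_iff₀ (by positivity), mul_one]
      exact this
    have h2 : M⁻¹ * (L * max t 0) ≤ 1 := by rw [inv_mul_le_iff₀ hM0, mul_one]; exact hδ'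
    linarith
  have hsm : StronglyMeasurable fun ω => ‖(n : ℝ)⁻¹ • ∑ j ∈ Finset.range n, F (Z j ω)‖ :=
    ((Finset.stronglyMeasurable_fun_sum _ fun j _ =>
      hFm.comp_measurable (hZ j)).const_smul _).norm
  have hint : Integrable (fun ω => Real.exp
      (M⁻¹ * ‖(n : ℝ)⁻¹ • ∑ j ∈ Finset.range n, F (Z j ω)‖)) P := by
    refine Integrable.of_bound (Real.continuous_exp.comp_stronglyMeasurable
      (hsm.const_mul _)).aestronglyMeasurable (Real.exp (M⁻¹ * c)) (ae_of_all _ fun ω => ?_)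
    rw [Real.norm_of_nonneg (Real.exp_pos _).le, Real.exp_le_exp]
    gcongr
    exact havg ω
  have hmark := measure_ge_le_exp_mul_mgf (μ := P) (4 * B * M) hu.le hint
  have htail : P.real {ω | 4 * B * M ≤ ‖(n : ℝ)⁻¹ • ∑ j ∈ Finset.range n, F (Z j ω)‖} ≤ η := by
    refine hmark.trans ?_
    have hη2 : η = 2 * Real.exp (-B) := by
      rw [hBdef, Real.exp_neg, Real.exp_log (by positivity)]
      field_simp
    calc Real.exp (-M⁻¹ * (4 * B * M)) * mgf _ P M⁻¹
        ≤ Real.exp (-(4 * B)) * (2 * Real.exp 4) := by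
          have e : -M⁻¹ * (4 * B * M) = -(4 * B) := by field_simp
          rw [e]
          gcongr
          exact hmgf.trans (by gcongr)
      _ = 2 * Real.exp (4 - 4 * B) := by rw [mul_left_comm, ← Real.exp_add]; ring_nf
      _ ≤ 2 * Real.exp (-B) := by gcongr; linarith
      _ = η := hη2.symm
  set S := {ω | ‖(n : ℝ)⁻¹ • ∑ j ∈ Finset.range n, F (Z j ω)‖ ≤ 4 * B * M} with hS
  have hSm : MeasurableSet S := measurableSet_le hsm.measurable measurable_const
  have hcompl : P.real Sᶜ ≤ η := by
    refine (measureReal_mono fun ω hω => ?_).trans htail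
    rw [Set.mem_compl_iff, hS, Set.mem_ofPred_eq, not_le] at hω
    exact hω.le
  rw [probReal_compl_eq_one_sub hSm] at hcompl
  rw [← ofReal_measureReal]
  exact ENNReal.ofReal_le_ofReal (by linarith)

end Bernstein

/-! ### Lipschitz continuity of the kernel sections -/

section KernelLipschitz

variable {E : Type*} [NormedAddCommGroup E] [NormedSpace ℝ E] {s : Set E}

/-- Mean value inequality along a segment of a convex set, for derivatives taken within the set. -/
theorem abs_sub_le_of_hasLineDerivWithinAt (hs : Convex ℝ s) {g g' : s → ℝ} {a b : s} {C : ℝ}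
    (hg : ∀ z : s, HasLineDerivWithinAt ℝ (Function.extend Subtype.val g 0) (g' z) s (z : E)
      ((b : E) - a))
    (hC : ∀ z, |g' z| ≤ C) : |g b - g a| ≤ C := by
  set f : E → ℝ := Function.extend Subtype.val g 0 with hf
  set u : E := (b : E) - a with hu
  have hfv : ∀ z : s, f z = g z := fun z => Subtype.val_injective.extend_apply g 0 z
  have hmem : ∀ t ∈ Set.Icc (0 : ℝ) 1, (a : E) + t • u ∈ s := fun t ht =>
    hs.add_smul_sub_mem a.2 b.2 ht
  have hder : ∀ t ∈ Set.Icc (0 : ℝ) 1, ∃ d : ℝ, |d| ≤ C ∧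
      HasDerivWithinAt (fun τ : ℝ => f (a + τ • u)) d (Set.Icc 0 1) t := by
    intro t ht
    refine ⟨g' ⟨_, hmem t ht⟩, hC _, ?_⟩
    have h1 : HasDerivWithinAt (fun τ : ℝ => f ((a : E) + t • u + τ • u)) (g' ⟨_, hmem t ht⟩)
      ((fun τ : ℝ => (a : E) + t • u + τ • u) ⁻¹' s) (t - t) := by
      rw [sub_self]; exact hg ⟨_, hmem t ht⟩
    have h2 : HasDerivWithinAt (fun τ : ℝ => τ - t) 1 (Set.Icc 0 1) t :=
      (hasDerivWithinAt_id t _).sub_const t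
    have h3 := HasDerivWithinAt.scomp (h := fun τ : ℝ => τ - t) t h1 h2 (fun τ hτ => by
      have e : (a : E) + t • u + (τ - t) • u = a + τ • u := by rw [sub_smul]; abel
      change (a : E) + t • u + (τ - t) • u ∈ s
      rw [e]
      exact hmem τ hτ)
    rw [one_smul] at h3
    refine h3.congr_of_mem (fun τ _ => ?_) ht
    have e : (a : E) + t • u + (τ - t) • u = a + τ • u := by rw [sub_smul]; abel
    simp only [Function.comp_apply, e]
  choose! d hd1 hd2 using hder
  have key := Convex.norm_image_sub_le_of_norm_hasDerivWithin_le (C := C) hd2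
    (fun t ht => by simpa using hd1 t ht) (convex_Icc 0 1) (Set.left_mem_Icc.2 zero_le_one)
    (Set.right_mem_Icc.2 zero_le_one)
  have e1 : (a : E) + (1 : ℝ) • u = b := by rw [one_smul, hu]; abel
  have e0 : (a : E) + (0 : ℝ) • u = a := by rw [zero_smul, add_zero]
  simpa only [e1, e0, hfv, sub_zero, norm_one, mul_one, Real.norm_eq_abs] using key

/-- The mixed second difference of `k`, bounded by the mean value inequality in each variable. -/
theorem abs_mixedDiff_le (hs : Convex ℝ s) {k : s → s → ℝ} {K : ℝ} (hk : HasBoundedMixedDeriv k K)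
    (a b : s) : |(k b b - k b a) - (k a b - k a a)| ≤ K * ‖(b : E) - a‖ ^ 2 := by
  obtain ⟨d₁, d₁₂, h⟩ := hk
  set u : E := (b : E) - a with hu
  refine abs_sub_le_of_hasLineDerivWithinAt (g := fun z => k z b - k z a)
    (g' := fun z => d₁ z b u - d₁ z a u) hs (fun z => ?_) (fun z => ?_)
  · have e : Function.extend Subtype.val (fun z : s => k z b - k z a) 0
        = Function.extend Subtype.val (fun z : s => k z b) (0 : E → ℝ)
          - Function.extend Subtype.val (fun z : s => k z a) 0 := by
      rw [← Function.extend_sub, sub_zero]; rfl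
    rw [e]
    exact HasDerivWithinAt.sub (h z b u 0).1 (h z a u 0).1
  · refine abs_sub_le_of_hasLineDerivWithinAt (g := fun y => d₁ z y u)
      (g' := fun y => d₁₂ z y u u) hs (fun y => (h z y u u).2.1) (fun y => ?_)
    rw [sq, ← mul_assoc]
    exact (h z y u u).2.2

variable {X H : Type*} [NormedAddCommGroup H] [InnerProductSpace ℝ H] [CompleteSpace H]
  [RKHS ℝ H X ℝ]

theorem inner_feat (x : X) (f : H) : inner ℝ (feat H x) f = f x := by
  simp [feat]

theorem ker_eq_inner (x y : X) : ker H x y = inner ℝ (feat H x) (feat H y) := by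
  rw [inner_feat, feat, RKHS.kerFun_apply, ker]

theorem norm_feat_le {x : X} (h : √(ker H x x) ≤ 1) : ‖feat H x‖ ≤ 1 := by
  rwa [ker_eq_inner, real_inner_self_eq_norm_sq, Real.sqrt_sq (norm_nonneg _)] at h

/-- The kernel sections are Lipschitz: `‖k_a - k_b‖²` is a mixed difference of the kernel, which is
bounded by the mixed derivative. -/
theorem norm_feat_sub_le [RKHS ℝ H s ℝ] (hs : Convex ℝ s) {K : ℝ}
    (hk : HasBoundedMixedDeriv (fun x y : s => ker H x y) K) (a b : s) :
    ‖feat H a - feat H b‖ ≤ kerLip K * dist a b := by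
  have h := (le_abs_self _).trans (abs_mixedDiff_le hs hk a b)
  have e : (ker H b b - ker H b a) - (ker H a b - ker H a a) = ‖feat H a - feat H b‖ ^ 2 := by
    simp only [ker_eq_inner]
    rw [norm_sub_sq_real, real_inner_self_eq_norm_sq, real_inner_self_eq_norm_sq,
      real_inner_comm (feat H a) (feat H b)]
    ring
  rw [e] at h
  have h2 := Real.le_sqrt_of_sq_le h
  rw [Real.sqrt_mul' _ (sq_nonneg _), Real.sqrt_sq (norm_nonneg _)] at h2
  rw [dist_comm, Subtype.dist_eq, dist_eq_norm]
  refine h2.trans ?_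
  gcongr
  exact le_max_right _ _

end KernelLipschitz

/-! ### Inverse square roots -/

section InverseSquareRoot

variable {H : Type*} [NormedAddCommGroup H] [InnerProductSpace ℝ H] [CompleteSpace H]

theorem IsInvSqrt.mul_mul_eq_one {S A : H →L[ℝ] H} (hS : IsSelfAdjoint S) (h : IsInvSqrt S A) :
    S * (A * A) = 1 := by
  have h2 := congrArg star h.2
  rwa [star_mul, star_mul, h.1.isSelfAdjoint.star_eq, hS.star_eq, star_one] at h2

/-- `‖(T + lam)^{-1/2}‖ ≤ lam^{-1/2}`. -/
theorem IsInvSqrt.norm_le {T A : H →L[ℝ] H} (hT : T.IsPositive) {lam : ℝ} (hlam : 0 < lam)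
    (h : IsInvSqrt (T + lam • (1 : H →L[ℝ] H)) A) : ‖A‖ ≤ (√lam)⁻¹ := by
  have hS : IsSelfAdjoint (T + lam • (1 : H →L[ℝ] H)) :=
    hT.isSelfAdjoint.add (IsSelfAdjoint.smul (IsSelfAdjoint.all _) (IsSelfAdjoint.one _))
  refine A.opNorm_le_bound (by positivity) fun x => ?_
  set y := A (A x) with hy
  have hxy : x = T y + lam • y := (DFunLike.congr_fun (h.mul_mul_eq_one hS) x).symm
  have e1 : ‖A x‖ ^ 2 = inner ℝ x y := by
    rw [← real_inner_self_eq_norm_sq, hy]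
    exact h.1.inner_left_eq_inner_right x (A x)
  have e2 : lam * ‖y‖ ^ 2 ≤ inner ℝ x y := by
    rw [hxy, inner_add_left, real_inner_smul_left, real_inner_self_eq_norm_sq]
    linarith [hT.inner_nonneg_left y]
  have e3 := real_inner_le_norm x y
  have e4 : ‖y‖ ≤ ‖x‖ / lam := by
    rw [le_div_iff₀ hlam]
    rcases (norm_nonneg y).eq_or_lt' with h0 | h0
    · rw [h0, zero_mul]; exact norm_nonneg _
    · exact le_of_mul_le_mul_right (by linarith : ‖y‖ * lam * ‖y‖ ≤ ‖x‖ * ‖y‖) h0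
  have e5 : ‖A x‖ ^ 2 ≤ ((√lam)⁻¹ * ‖x‖) ^ 2 := by
    rw [e1, mul_pow, inv_pow, Real.sq_sqrt hlam.le]
    calc (inner ℝ x y : ℝ) ≤ ‖x‖ * ‖y‖ := e3
      _ ≤ ‖x‖ * (‖x‖ / lam) := by gcongr
      _ = _ := by field_simp
  exact le_of_sq_le_sq e5 (by positivity)

theorem IsInvSqrt.ringInverse_eq {S A : H →L[ℝ] H} (hS : IsSelfAdjoint S) (h : IsInvSqrt S A) :
    Ring.inverse S = A * A :=
  Ring.inverse_unit ⟨S, A * A, h.mul_mul_eq_one hS, h.2⟩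

variable (H) in
/-- The index type of `onb H` is only an arbitrary one; it is countable because orthonormal vectors
are at distance `√2` from each other. -/
theorem countable_onb_index [SecondCountableTopology H] :
    Countable (exists_hilbertBasis ℝ H).choose := by
  refine Pairwise.countable_of_isOpen_disjoint (s := fun i => Metric.ball (onb H i) (1 / 2))
    (fun i j hij => ?_) (fun i => Metric.isOpen_ball) (fun i => Metric.nonempty_ball.2 (by norm_num))
  refine Metric.ball_disjoint_ball ?_
  have ho := (onb H).orthonormal
  have h2 : ‖onb H i - onb H j‖ ^ 2 = 2 := by
    rw [norm_sub_sq_real, ho.1 i, ho.1 j, ho.2 hij]; norm_num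
  rw [dist_eq_norm]
  nlinarith [norm_nonneg (onb H i - onb H j)]

end InverseSquareRoot

/-! ### Hilbert–Schmidt operators -/

section HilbertSchmidt

variable {H : Type*} [NormedAddCommGroup H] [InnerProductSpace ℝ H] [CompleteSpace H]

variable (H) in
/-- The Hilbert space of Hilbert–Schmidt operators `B`, encoded by the sequence of the values
`B eᵢ` on the Hilbert basis `onb H`. -/
abbrev HSSpace : Type _ := lp (fun _ : (exists_hilbertBasis ℝ H).choose => H) 2

theorem HSSpace.norm_sq_eq_tsum (w : HSSpace H) : ‖w‖ ^ 2 = ∑' i, ‖w i‖ ^ 2 := by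
  rw [← real_inner_self_eq_norm_sq, lp.inner_eq_tsum]
  simp only [real_inner_self_eq_norm_sq]

theorem HSSpace.summable_norm_sq (w : HSSpace H) : Summable fun i => ‖w i‖ ^ 2 := by
  simpa only [real_inner_self_eq_norm_sq] using lp.summable_inner (𝕜 := ℝ) w w

theorem hasSum_sq_inner_onb (b : H) :
    HasSum (fun i => (inner ℝ b (onb H i) : ℝ) ^ 2) (‖b‖ ^ 2) := by
  have := (onb H).hasSum_inner_mul_inner b b
  simpa only [real_inner_self_eq_norm_sq, real_inner_comm b, ← sq] using this

/-- The rank-one operator `f ↦ ⟪b, f⟫ a` as a Hilbert–Schmidt operator. -/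
noncomputable def hsRankOne (b a : H) : HSSpace H :=
  ⟨fun i => (inner ℝ b (onb H i) : ℝ) • a, by
    refine memℓp_gen ?_
    have h := (hasSum_sq_inner_onb b).summable.mul_right (‖a‖ ^ 2)
    refine h.congr fun i => ?_
    simp [norm_smul, mul_pow]⟩

theorem hsRankOne_apply (b a : H) (i) : hsRankOne b a i = (inner ℝ b (onb H i) : ℝ) • a := rfl

theorem norm_hsRankOne (b a : H) : ‖hsRankOne b a‖ = ‖b‖ * ‖a‖ := by
  have h : ‖hsRankOne b a‖ ^ 2 = (‖b‖ * ‖a‖) ^ 2 := by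
    rw [HSSpace.norm_sq_eq_tsum, mul_pow, ← ((hasSum_sq_inner_onb b).mul_right _).tsum_eq]
    refine tsum_congr fun i => ?_
    rw [hsRankOne_apply, norm_smul, mul_pow, Real.norm_eq_abs, sq_abs]
  exact (sq_eq_sq₀ (norm_nonneg _) (by positivity)).1 h

theorem norm_hsRankOne_sub_le (b a b' a' : H) :
    ‖hsRankOne b a - hsRankOne b' a'‖ ≤ ‖b - b'‖ * ‖a‖ + ‖b'‖ * ‖a - a'‖ := by
  have e : hsRankOne b a - hsRankOne b' a' = hsRankOne (b - b') a + hsRankOne b' (a - a') := by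
    ext i
    simp only [lp.coeFn_sub, lp.coeFn_add, Pi.sub_apply, Pi.add_apply, hsRankOne_apply,
      inner_sub_left, sub_smul, smul_sub]
    abel
  rw [e, ← norm_hsRankOne, ← norm_hsRankOne]
  exact norm_add_le _ _

/-- The operator norm is at most the Hilbert–Schmidt norm. -/
theorem norm_le_of_hs {B : H →L[ℝ] H} {w : HSSpace H} (hw : ∀ i, w i = B (onb H i)) :
    ‖B‖ ≤ ‖w‖ := by
  refine B.opNorm_le_bound (norm_nonneg _) fun x => ?_
  -- `⟪x ⊗ B x, B⟫ = ‖B x‖²` in the Hilbert–Schmidt inner product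
  have e : (inner ℝ (hsRankOne x (B x)) w : ℝ) = ‖B x‖ ^ 2 := by
    rw [lp.inner_eq_tsum, ← real_inner_self_eq_norm_sq, ← ContinuousLinearMap.adjoint_inner_right,
      ← (onb H).tsum_inner_mul_inner]
    refine tsum_congr fun i => ?_
    rw [hsRankOne_apply, hw, real_inner_smul_left, ContinuousLinearMap.adjoint_inner_right,
      real_inner_comm (B x)]
  have h := real_inner_le_norm (hsRankOne x (B x)) w
  rw [e, norm_hsRankOne] at h
  rcases (norm_nonneg (B x)).eq_or_lt' with h0 | h0
  · rw [h0]; positivity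
  · exact le_of_mul_le_mul_right (by linarith : ‖B x‖ * ‖B x‖ ≤ ‖w‖ * ‖x‖ * ‖B x‖) h0

theorem hsNorm_eq_of_hs {B : H →L[ℝ] H} {w : HSSpace H} (hw : ∀ i, w i = B (onb H i)) :
    hsNorm B = ENNReal.ofReal ‖w‖ := by
  have h : ∑' i, ‖B (onb H i)‖ₑ ^ 2 = ENNReal.ofReal (‖w‖ ^ 2) := by
    rw [HSSpace.norm_sq_eq_tsum,
      ENNReal.ofReal_tsum_of_nonneg (fun i => by positivity) (HSSpace.summable_norm_sq w)]
    refine tsum_congr fun i => ?_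
    rw [← hw, ENNReal.ofReal_pow (norm_nonneg _), ofReal_norm]
  rw [hsNorm, h, ENNReal.ofReal_rpow_of_nonneg (by positivity) (by norm_num),
    ← Real.sqrt_eq_rpow, Real.sqrt_sq (norm_nonneg _)]

end HilbertSchmidt

/-! ### The covariance operator and the effective dimension -/

section Covariance

variable {X : Type*} [TopologicalSpace X] [SecondCountableTopology X] [MeasurableSpace X]
  [OpensMeasurableSpace X] {H : Type*} [NormedAddCommGroup H] [InnerProductSpace ℝ H]
  [CompleteSpace H] [RKHS ℝ H X ℝ] {μ : Measure X} [IsFiniteMeasure μ]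

theorem integrable_of_continuous_of_bound {V : Type*} [NormedAddCommGroup V] {g : X → V}
    (hg : Continuous g) {B : ℝ} (hB : ∀ x, ‖g x‖ ≤ B) : Integrable g μ :=
  Integrable.of_bound hg.stronglyMeasurable.aestronglyMeasurable B (ae_of_all _ hB)

theorem integrable_rankOneOp (hc : Continuous (feat H (X := X)))
    (h1 : ∀ x : X, ‖feat H x‖ ≤ 1) : Integrable (rankOneOp H (X := X)) μ := by
  refine integrable_of_continuous_of_bound (B := 1)
    (((InnerProductSpace.rankOne ℝ).continuous.comp hc).clm_apply hc) fun x => ?_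
  rw [rankOneOp, InnerProductSpace.norm_rankOne]
  exact mul_le_one₀ (h1 x) (norm_nonneg _) (h1 x)

theorem covOp_apply (hc : Continuous (feat H (X := X))) (h1 : ∀ x : X, ‖feat H x‖ ≤ 1) (f : H) :
    covOp H μ f = ∫ x, (inner ℝ (feat H x) f : ℝ) • feat H x ∂μ :=
  ContinuousLinearMap.integral_apply (integrable_rankOneOp hc h1) f

theorem integrable_inner_smul_feat (hc : Continuous (feat H (X := X)))
    (h1 : ∀ x : X, ‖feat H x‖ ≤ 1) (f : H) :
    Integrable (fun x => (inner ℝ (feat H x) f : ℝ) • feat H x) μ := by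
  refine integrable_of_continuous_of_bound (B := ‖f‖) ((hc.inner continuous_const).smul hc)
    fun x => ?_
  rw [norm_smul]
  have := norm_inner_le_norm (𝕜 := ℝ) (feat H x) f
  calc _ ≤ 1 * ‖f‖ * 1 := by
        have h := h1 x
        gcongr
        exact this.trans (by gcongr)
    _ = ‖f‖ := by ring

theorem inner_covOp (hc : Continuous (feat H (X := X))) (h1 : ∀ x : X, ‖feat H x‖ ≤ 1)
    (f g : H) : inner ℝ (covOp H μ f) g
      = ∫ x, (inner ℝ (feat H x) f * inner ℝ (feat H x) g : ℝ) ∂μ := by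
  rw [covOp_apply hc h1, real_inner_comm, ← integral_inner (integrable_inner_smul_feat hc h1 f)]
  simp only [real_inner_smul_right, real_inner_comm g]

theorem isPositive_covOp (hc : Continuous (feat H (X := X))) (h1 : ∀ x : X, ‖feat H x‖ ≤ 1) :
    (covOp H μ).IsPositive := by
  rw [ContinuousLinearMap.isPositive_iff]
  refine ⟨fun f g => ?_, fun f => ?_⟩
  · change inner ℝ (covOp H μ f) g = inner ℝ f (covOp H μ g)
    rw [real_inner_comm (covOp H μ g), inner_covOp hc h1, inner_covOp hc h1]
    simp only [mul_comm]
  · rw [inner_covOp hc h1]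
    exact integral_nonneg fun x => mul_self_nonneg _

/-- The effective dimension is `Tr (A T A) = ∫ ‖A k_x‖² μ(dx)`, where `A = (T + lam)^{-1/2}`. The
interchange of trace and integral is dominated convergence. -/
theorem effDim_eq_integral [SecondCountableTopology H] (hc : Continuous (feat H (X := X)))
    (h1 : ∀ x : X, ‖feat H x‖ ≤ 1) {lam : ℝ} (hlam : 0 < lam) :
    effDim (covOp H μ) lam
      = ∫ x, ‖invSqrt (covOp H μ + lam • (1 : H →L[ℝ] H)) (feat H x)‖ ^ 2 ∂μ := by
  have hT := isPositive_covOp (μ := μ) hc h1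
  have hinv := isInvSqrt_invSqrt hT hlam
  set A := invSqrt (covOp H μ + lam • (1 : H →L[ℝ] H)) with hA
  have hS : IsSelfAdjoint (covOp H μ + lam • (1 : H →L[ℝ] H)) :=
    hT.isSelfAdjoint.add (IsSelfAdjoint.smul (IsSelfAdjoint.all _) (IsSelfAdjoint.one _))
  have hsym : ∀ x y, inner ℝ (A x) y = (inner ℝ x (A y) : ℝ) := hinv.1.inner_left_eq_inner_right
  have := countable_onb_index H
  set e := onb H with he
  have hAc : Continuous fun x : X => A (A (feat H x)) := A.continuous.comp (A.continuous.comp hc)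
  have hterm : ∀ i, inner ℝ (e i) ((Ring.inverse (covOp H μ + lam • (1 : H →L[ℝ] H))
      * covOp H μ) (e i))
      = ∫ x, (inner ℝ (feat H x) (e i) * inner ℝ (e i) (A (A (feat H x))) : ℝ) ∂μ := by
    intro i
    rw [hinv.ringInverse_eq hS]
    change inner ℝ (e i) (A (A (covOp H μ (e i)))) = _
    rw [← hsym, ← hsym, real_inner_comm, inner_covOp hc h1]
    refine integral_congr_ae (ae_of_all _ fun x => ?_)
    simp only
    rw [← hsym, ← hsym, real_inner_comm (A (A (feat H x)))]
  rw [effDim, opTrace]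
  simp only [← he, hterm]
  have hbs : ∀ x, HasSum (fun i => (inner ℝ (feat H x) (e i) : ℝ) ^ 2
      + (inner ℝ (A (A (feat H x))) (e i) : ℝ) ^ 2)
      (‖feat H x‖ ^ 2 + ‖A (A (feat H x))‖ ^ 2) := fun x =>
    (hasSum_sq_inner_onb _).add (hasSum_sq_inner_onb _)
  have hbi : Integrable (fun x : X => ‖feat H x‖ ^ 2 + ‖A (A (feat H x))‖ ^ 2) μ := by
    refine integrable_of_continuous_of_bound (B := 1 + (‖A‖ * ‖A‖) ^ 2)
      ((hc.norm.pow 2).add (hAc.norm.pow 2)) fun x => ?_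
    rw [Real.norm_of_nonneg (by positivity)]
    have e1 := h1 x
    have e2 : ‖A (A (feat H x))‖ ≤ ‖A‖ * ‖A‖ := by
      calc ‖A (A (feat H x))‖ ≤ ‖A‖ * (‖A‖ * ‖feat H x‖) :=
            (A.le_opNorm _).trans (by gcongr; exact A.le_opNorm _)
        _ ≤ ‖A‖ * (‖A‖ * 1) := by gcongr
        _ = _ := by rw [mul_one]
    have e3 : ‖feat H x‖ ^ 2 ≤ 1 := pow_le_one₀ (norm_nonneg _) e1
    gcongr
  have key := hasSum_integral_of_dominated_convergence (μ := μ)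
    (F := fun i x => (inner ℝ (feat H x) (e i) * inner ℝ (e i) (A (A (feat H x))) : ℝ))
    (f := fun x => ‖A (feat H x)‖ ^ 2)
    (fun i x => (inner ℝ (feat H x) (e i) : ℝ) ^ 2 + (inner ℝ (A (A (feat H x))) (e i) : ℝ) ^ 2)
    (fun i => ((hc.inner continuous_const).mul
      (continuous_const.inner hAc)).stronglyMeasurable.aestronglyMeasurable)
    (fun i => ae_of_all _ fun x => by
      rw [Real.norm_eq_abs, real_inner_comm (A (A (feat H x))), abs_le]
      constructor <;> nlinarith [sq_nonneg ((inner ℝ (feat H x) (e i) : ℝ)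
        + inner ℝ (A (A (feat H x))) (e i)), sq_nonneg ((inner ℝ (feat H x) (e i) : ℝ)
        - inner ℝ (A (A (feat H x))) (e i)), sq_nonneg (inner ℝ (feat H x) (e i) : ℝ),
        sq_nonneg (inner ℝ (A (A (feat H x))) (e i) : ℝ)])
    (ae_of_all _ fun x => (hbs x).summable)
    (by simpa only [(hbs _).tsum_eq] using hbi)
    (ae_of_all _ fun x => by
      have := e.hasSum_inner_mul_inner (feat H x) (A (A (feat H x)))
      rwa [← hsym, real_inner_self_eq_norm_sq] at this)
  exact key.tsum_eq

end Covariance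

/-! ### Truncated residuals -/

section Truncation

/-- Truncation of a real number to `[-R, R]`. -/
def truncate (R y : ℝ) : ℝ := max (-R) (min R y)

theorem abs_truncate_le {R : ℝ} (hR : 0 ≤ R) (y : ℝ) : |truncate R y| ≤ R :=
  abs_le.2 ⟨le_max_left _ _, max_le (by linarith) (min_le_left _ _)⟩

theorem truncate_of_abs_le {R y : ℝ} (h : |y| ≤ R) : truncate R y = y := by
  rw [truncate, min_eq_right (abs_le.1 h).2, max_eq_right (abs_le.1 h).1]

theorem abs_truncate_sub_le (R y y' : ℝ) : |truncate R y - truncate R y'| ≤ |y - y'| := by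
  have h1 := abs_max_sub_max_le_max (-R) (min R y) (-R) (min R y')
  have h2 := abs_min_sub_min_le_max R y R y'
  simp only [sub_self, abs_zero, abs_nonneg, sup_of_le_right] at h1 h2
  exact h1.trans h2

theorem continuous_truncate (R : ℝ) : Continuous (truncate R) := by
  unfold truncate; fun_prop

end Truncation

section Residual

variable {X H : Type*} [NormedAddCommGroup H] [InnerProductSpace ℝ H] [RKHS ℝ H X ℝ]

theorem RegressionClass.ae_ae_abs_le [MeasurableSpace X] {ν : Measure (X × ℝ)}
    [IsProbabilityMeasure ν] {f : H} {R Sig : ℝ} (h : RegressionClass ν f R Sig) :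
    ∀ᵐ x ∂ν.fst, ∀ᵐ y ∂(ν.condKernel x), |y| ≤ R := by
  refine Measure.ae_ae_of_ae_compProd (p := fun z : X × ℝ => |z.2| ≤ R) ?_
  rw [ν.disintegrate ν.condKernel]
  exact h.bounded

/-- The regression function inherits the bound on the target. -/
theorem RegressionClass.ae_abs_apply_le [MeasurableSpace X] {ν : Measure (X × ℝ)}
    [IsProbabilityMeasure ν] {f : H} {R Sig : ℝ} (h : RegressionClass ν f R Sig) :
    ∀ᵐ x ∂ν.fst, |f x| ≤ R := by
  filter_upwards [h.ae_ae_abs_le, h.regression] with x hx hfx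
  rw [← hfx]
  simpa using norm_integral_le_of_norm_le_const (μ := ν.condKernel x) (f := fun y : ℝ => y) hx

variable [CompleteSpace H] {f : H} {R : ℝ}

theorem constC_pos (κ R D : ℝ) : 0 < constC κ R D := by
  rw [constC]; linarith [le_max_left 1 (max (κ * R) (κ * D))]

/-- The residual `(y - f x) k_x`, with the target and the prediction truncated to `[-R, R]` so as
to be bounded and Lipschitz everywhere. -/
noncomputable def residual (A : H →L[ℝ] H) (f : H) (R : ℝ) (z : X × ℝ) : H :=
  (truncate R z.2 - truncate R (f z.1)) • A (feat H z.1)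

theorem RegressionClass.ae_residual_eq [MeasurableSpace X] {ν : Measure (X × ℝ)}
    [IsProbabilityMeasure ν] {Sig : ℝ} (h : RegressionClass ν f R Sig) (A : H →L[ℝ] H) :
    ∀ᵐ z ∂ν, residual A f R z = (z.2 - f z.1) • A (feat H z.1) := by
  filter_upwards [h.bounded, ae_of_ae_map measurable_fst.aemeasurable h.ae_abs_apply_le]
    with z h1 h2
  rw [residual, truncate_of_abs_le h1, truncate_of_abs_le h2]

theorem norm_residual_le (h1 : ∀ x : X, ‖feat H x‖ ≤ 1) (hR : 0 ≤ R) {A : H →L[ℝ] H} {α : ℝ}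
    (hA : ‖A‖ ≤ α) (z : X × ℝ) : ‖residual A f R z‖ ≤ 2 * R * α := by
  rw [residual, norm_smul, Real.norm_eq_abs]
  have e1 : |truncate R z.2 - truncate R (f z.1)| ≤ 2 * R := by
    have := abs_sub (truncate R z.2) (truncate R (f z.1))
    linarith [abs_truncate_le hR z.2, abs_truncate_le hR (f z.1)]
  have e2 : ‖A (feat H z.1)‖ ≤ α := by
    simpa using A.le_of_opNorm_le_of_le hA (h1 z.1)
  gcongr

variable [PseudoMetricSpace X] {κ : ℝ}

theorem continuous_feat (hL : ∀ x y : X, ‖feat H x - feat H y‖ ≤ κ * dist x y) :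
    Continuous (feat H (X := X)) :=
  (LipschitzWith.of_dist_le' (K := κ) fun x y => by rw [dist_eq_norm]; exact hL x y).continuous

/-- The truncated residual is Lipschitz on all of `X × ℝ`. The factor `3` of `constC` collects the
variation of `y`, of `f`, and of `k_x` (twice, as the residual is bounded by `2 R`). -/
theorem norm_residual_sub_le (h1 : ∀ x : X, ‖feat H x‖ ≤ 1)
    (hL : ∀ x y : X, ‖feat H x - feat H y‖ ≤ κ * dist x y) (hκ : 0 < κ) (hR : 0 ≤ R) {D : ℝ}
    (hD : ‖f‖ ≤ D) {A : H →L[ℝ] H} {α : ℝ} (hA : ‖A‖ ≤ α) (z w : X × ℝ) :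
    ‖residual A f R z - residual A f R w‖
      ≤ constC κ R D * α * (dist z.1 w.1 + |z.2 - w.2|) := by
  have hα : 0 ≤ α := (norm_nonneg _).trans hA
  set ρz := truncate R z.2 - truncate R (f z.1) with hρz
  set ρw := truncate R w.2 - truncate R (f w.1) with hρw
  have hρ : |ρw| ≤ 2 * R := by
    have := abs_sub (truncate R w.2) (truncate R (f w.1))
    linarith [abs_truncate_le hR w.2, abs_truncate_le hR (f w.1)]
  have hf : |f z.1 - f w.1| ≤ κ * D * dist z.1 w.1 := by
    rw [← inner_feat, ← inner_feat, ← inner_sub_left]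
    refine (abs_real_inner_le_norm _ _).trans ?_
    calc ‖feat H z.1 - feat H w.1‖ * ‖f‖ ≤ (κ * dist z.1 w.1) * D := by
          gcongr; exact hL _ _
      _ = _ := by ring
  have hρρ : |ρz - ρw| ≤ |z.2 - w.2| + κ * D * dist z.1 w.1 := by
    have e : ρz - ρw = (truncate R z.2 - truncate R w.2)
        - (truncate R (f z.1) - truncate R (f w.1)) := by rw [hρz, hρw]; ring
    rw [e]
    refine (abs_sub _ _).trans (add_le_add (abs_truncate_sub_le _ _ _) ?_)
    exact (abs_truncate_sub_le _ _ _).trans hf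
  have e : residual A f R z - residual A f R w
      = (ρz - ρw) • A (feat H z.1) + ρw • A (feat H z.1 - feat H w.1) := by
    rw [residual, residual, map_sub, sub_smul ρz, smul_sub]; abel
  have e1 : ‖A (feat H z.1)‖ ≤ α := by simpa using A.le_of_opNorm_le_of_le hA (h1 z.1)
  have e2 : ‖A (feat H z.1 - feat H w.1)‖ ≤ α * (κ * dist z.1 w.1) :=
    A.le_of_opNorm_le_of_le hA (hL _ _)
  have hd : 0 ≤ dist z.1 w.1 := dist_nonneg
  have hm1 : 1 ≤ max 1 (max (κ * R) (κ * D)) := le_max_left _ _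
  have hm2 : κ * R ≤ max 1 (max (κ * R) (κ * D)) := (le_max_left _ _).trans (le_max_right _ _)
  have hm3 : κ * D ≤ max 1 (max (κ * R) (κ * D)) := (le_max_right _ _).trans (le_max_right _ _)
  rw [constC]
  set m := max 1 (max (κ * R) (κ * D))
  calc ‖residual A f R z - residual A f R w‖
      ≤ |ρz - ρw| * ‖A (feat H z.1)‖ + |ρw| * ‖A (feat H z.1 - feat H w.1)‖ := by
        rw [e]
        refine (norm_add_le _ _).trans_eq ?_
        rw [norm_smul, norm_smul, Real.norm_eq_abs, Real.norm_eq_abs]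
    _ ≤ (|z.2 - w.2| + κ * D * dist z.1 w.1) * α + 2 * R * (α * (κ * dist z.1 w.1)) := by
        have := (abs_nonneg _).trans hρρ
        gcongr
    _ = (|z.2 - w.2| + κ * D * dist z.1 w.1 + 2 * (κ * R) * dist z.1 w.1) * α := by ring
    _ ≤ (3 * m * |z.2 - w.2| + m * dist z.1 w.1 + 2 * m * dist z.1 w.1) * α := by
        gcongr
        have := abs_nonneg (z.2 - w.2)
        nlinarith
    _ = _ := by ring

end Residual

/-! ### Deviation of the residual and of the empirical covariance -/

section Deviations

variable {Ω : Type*} [MeasurableSpace Ω] {P : Measure Ω} [IsProbabilityMeasure P]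
  {X : Type*} [PseudoMetricSpace X] [SecondCountableTopology X] [MeasurableSpace X]
  [BorelSpace X] {Z : ℕ → Ω → X × ℝ} {ν : Measure (X × ℝ)}

/-- Bernstein's inequality with the moments expressed in terms of the common law `ν`. -/
theorem prob_norm_average_le_of_law {V : Type*} [NormedAddCommGroup V] [InnerProductSpace ℝ V]
    (hZ : ∀ j, Measurable (Z j)) (hν : ∀ j, P.map (Z j) = ν) {F : X × ℝ → V}
    (hFc : Continuous F) {c L : ℝ} (hc : 0 < c) (hL : 0 < L) (hB : ∀ z, ‖F z‖ ≤ c)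
    (hF : ∀ z w, ‖F z - F w‖ ≤ L * (dist z.1 w.1 + |z.2 - w.2|)) {n ℓ : ℕ} (hℓ : 1 ≤ ℓ)
    (hℓn : ℓ ≤ n) {σ : ℝ} {t : ℝ} (hτ : tauCoeff P Z (n / ℓ) ≤ ENNReal.ofReal t)
    (hδ : ℓ = 1 ∨ L * t ≤ max (c / (ℓ : ℝ)) (σ / √(ℓ : ℝ)))
    (h0 : ∀ v : V, ∫ z, inner ℝ v (F z) ∂ν = 0)
    (hs : ∫ z, ‖F z‖ ^ 2 ∂ν ≤ σ ^ 2) (hσ : 0 ≤ σ) {η : ℝ} (hη : 0 < η) (hη' : η ≤ 1 / 2) :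
    ENNReal.ofReal (1 - η) ≤ P {ω | ‖(n : ℝ)⁻¹ • ∑ j : Fin n, F (Z j ω)‖
      ≤ 4 * Real.log (2 * η⁻¹) * max (c / (ℓ : ℝ)) (σ / √(ℓ : ℝ))} := by
  have key := prob_norm_average_le hZ hFc.stronglyMeasurable hc hL hB hF hℓ hℓn hτ hδ
    (fun j v => by
      rw [← h0 v, ← hν j, integral_map (hZ j).aemeasurable
        (continuous_const.inner hFc).stronglyMeasurable.aestronglyMeasurable])
    (fun j => by
      refine le_trans (le_of_eq ?_) hs
      rw [← hν j]
      exact (integral_map (f := fun z => ‖F z‖ ^ 2) (hZ j).aemeasurable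
        (hFc.norm.pow 2).stronglyMeasurable.aestronglyMeasurable).symm) hσ hη hη'
  simpa only [Finset.sum_range] using key

variable [IsProbabilityMeasure ν] {H : Type*} [NormedAddCommGroup H] [InnerProductSpace ℝ H]
  [CompleteSpace H] [RKHS ℝ H X ℝ] {κ : ℝ}

section Residual

variable {f : H} {R Sig : ℝ}

theorem RegressionClass.integral_inner_residual (h : RegressionClass ν f R Sig)
    (hc : Continuous (feat H (X := X))) (hfc : Continuous f)
    (h1 : ∀ x : X, ‖feat H x‖ ≤ 1) (A : H →L[ℝ] H) (v : H) :
    ∫ z, inner ℝ v (residual A f R z) ∂ν = 0 := by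
  have hrc : Continuous (residual (X := X) A f R) :=
    (((continuous_truncate R).comp continuous_snd).sub
      ((continuous_truncate R).comp (hfc.comp continuous_fst))).smul
      (A.continuous.comp (hc.comp continuous_fst))
  have hi : Integrable (fun z => (inner ℝ v (residual A f R z) : ℝ)) ν :=
    integrable_of_continuous_of_bound (B := ‖v‖ * (2 * R * ‖A‖)) (continuous_const.inner hrc)
      fun z => (norm_inner_le_norm _ _).trans
        (by gcongr; exact norm_residual_le h1 h.R_pos.le le_rfl z)
  have hae : (fun z => (inner ℝ v (residual A f R z) : ℝ))
      =ᵐ[ν] fun z => (z.2 - f z.1) * inner ℝ v (A (feat H z.1)) := by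
    filter_upwards [h.ae_residual_eq A] with z hz
    rw [hz, real_inner_smul_right]
  rw [integral_congr_ae hae, ← Measure.integral_condKernel (hi.congr hae)]
  refine integral_eq_zero_of_ae ?_
  filter_upwards [h.ae_ae_abs_le, h.regression] with x hx hfx
  have hy : Integrable (fun y : ℝ => y) (ν.condKernel x) :=
    Integrable.of_bound measurable_id.aestronglyMeasurable R hx
  simp only [Pi.zero_apply]
  rw [integral_mul_const, integral_sub hy (integrable_const _), hfx]
  simp

theorem RegressionClass.integral_norm_sq_residual_le (h : RegressionClass ν f R Sig)
    (hc : Continuous (feat H (X := X))) (hfc : Continuous f)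
    (h1 : ∀ x : X, ‖feat H x‖ ≤ 1) (A : H →L[ℝ] H) :
    ∫ z, ‖residual A f R z‖ ^ 2 ∂ν ≤ Sig ^ 2 * ∫ x, ‖A (feat H x)‖ ^ 2 ∂ν.fst := by
  have hrc : Continuous (residual (X := X) A f R) :=
    (((continuous_truncate R).comp continuous_snd).sub
      ((continuous_truncate R).comp (hfc.comp continuous_fst))).smul
      (A.continuous.comp (hc.comp continuous_fst))
  have hi : Integrable (fun z => ‖residual A f R z‖ ^ 2) ν :=
    integrable_of_continuous_of_bound (B := (2 * R * ‖A‖) ^ 2) (hrc.norm.pow 2) fun z => by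
      rw [Real.norm_of_nonneg (by positivity)]
      gcongr
      exact norm_residual_le h1 h.R_pos.le le_rfl z
  have hae : (fun z => ‖residual A f R z‖ ^ 2)
      =ᵐ[ν] fun z => (z.2 - f z.1) ^ 2 * ‖A (feat H z.1)‖ ^ 2 := by
    filter_upwards [h.ae_residual_eq A] with z hz
    rw [hz, norm_smul, mul_pow, Real.norm_eq_abs, sq_abs]
  have hAi : Integrable (fun x : X => ‖A (feat H x)‖ ^ 2) ν.fst :=
    integrable_of_continuous_of_bound (B := ‖A‖ ^ 2) ((A.continuous.comp hc).norm.pow 2)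
      fun x => by
        rw [Real.norm_of_nonneg (by positivity)]
        gcongr
        simpa using A.le_of_opNorm_le_of_le le_rfl (h1 x)
  rw [integral_congr_ae hae, ← Measure.integral_condKernel (hi.congr hae), ← integral_const_mul]
  refine integral_mono_of_nonneg (ae_of_all _ fun x => integral_nonneg fun y => by positivity)
    (hAi.const_mul _) ?_
  filter_upwards [h.variance] with x hx
  rw [integral_mul_const]
  gcongr

/-- Deviation of the residual mean, seen through a bounded operator `A`. -/
theorem RegressionClass.prob_norm_residual_le (h : RegressionClass ν f R Sig)
    (hZ : ∀ j, Measurable (Z j)) (hν : ∀ j, P.map (Z j) = ν)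
    (h1 : ∀ x : X, ‖feat H x‖ ≤ 1)
    (hL : ∀ x y : X, ‖feat H x - feat H y‖ ≤ κ * dist x y) (hκ : 0 < κ) {D : ℝ}
    (hD : ‖f‖ ≤ D) {A : H →L[ℝ] H} {α s : ℝ} (hα : 0 < α) (hA : ‖A‖ ≤ α) (hs0 : 0 ≤ s)
    (hs : ∫ x, ‖A (feat H x)‖ ^ 2 ∂ν.fst ≤ s ^ 2) {n ℓ : ℕ} (hℓ : 1 ≤ ℓ) (hℓn : ℓ ≤ n) {t : ℝ}
    (hτ : tauCoeff P Z (n / ℓ) ≤ ENNReal.ofReal t)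
    (hδ : ℓ = 1 ∨ constC κ R D * α * t ≤ max (2 * R * α / (ℓ : ℝ)) (Sig * s / √(ℓ : ℝ)))
    {η : ℝ} (hη : 0 < η) (hη' : η ≤ 1 / 2) :
    ENNReal.ofReal (1 - η) ≤ P {ω | ‖A (empCovOp H (fun j : Fin n => (Z j ω).1) f
        - empAdj H (fun j : Fin n => (Z j ω).1) (fun j => (Z j ω).2))‖
      ≤ 4 * Real.log (2 * η⁻¹) * max (2 * R * α / (ℓ : ℝ)) (Sig * s / √(ℓ : ℝ))} := by
  have hc := continuous_feat hL
  have hfc : Continuous f := by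
    have e : (f : X → ℝ) = fun x => inner ℝ (feat H x) f := funext fun x => (inner_feat x f).symm
    rw [e]
    exact hc.inner continuous_const
  have hrc : Continuous (residual (X := X) A f R) :=
    (((continuous_truncate R).comp continuous_snd).sub
      ((continuous_truncate R).comp (hfc.comp continuous_fst))).smul
      (A.continuous.comp (hc.comp continuous_fst))
  have hR := h.R_pos
  have hSig := h.Sig_pos
  have key := prob_norm_average_le_of_law hZ hν hrc (by positivity : 0 < 2 * R * α)
    (mul_pos (constC_pos κ R D) hα) (norm_residual_le h1 hR.le hA)
    (norm_residual_sub_le h1 hL hκ hR.le hD hA) hℓ hℓn hτ hδ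
    (h.integral_inner_residual hc hfc h1 A)
    ((h.integral_norm_sq_residual_le hc hfc h1 A).trans
      (by rw [mul_pow]; gcongr)) (by positivity) hη hη'
  refine key.trans (measure_mono_ae ?_)
  have hall : ∀ᵐ ω ∂P, ∀ j : Fin n, residual A f R (Z j ω)
      = ((Z j ω).2 - f (Z j ω).1) • A (feat H (Z j ω).1) := by
    rw [ae_all_iff]
    intro j
    have := h.ae_residual_eq A
    rw [← hν j] at this
    exact ae_of_ae_map (hZ j).aemeasurable this
  filter_upwards [hall] with ω hω hmem
  have e : A (empCovOp H (fun j : Fin n => (Z j ω).1) f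
        - empAdj H (fun j : Fin n => (Z j ω).1) (fun j => (Z j ω).2))
      = -((n : ℝ)⁻¹ • ∑ j : Fin n, residual A f R (Z j ω)) := by
    simp only [hω, empCovOp, empAdj, rankOneOp, _root_.smul_apply,
      _root_.sum_apply, InnerProductSpace.rankOne_apply, inner_feat]
    rw [← smul_sub, ← Finset.sum_sub_distrib, map_smul, map_sum, ← smul_neg,
      ← Finset.sum_neg_distrib]
    congr 1
    refine Finset.sum_congr rfl fun j _ => ?_
    rw [← sub_smul, map_smul, ← neg_smul, neg_sub]
  change ‖A _‖ ≤ _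
  rw [e, norm_neg]
  exact hmem

end Residual

/-- Deviation of the empirical covariance, seen through a bounded operator `A`, in operator and
Hilbert–Schmidt norm. -/
theorem prob_norm_covOp_sub_le (hZ : ∀ j, Measurable (Z j)) (hν : ∀ j, P.map (Z j) = ν)
    (h1 : ∀ x : X, ‖feat H x‖ ≤ 1)
    (hL : ∀ x y : X, ‖feat H x - feat H y‖ ≤ κ * dist x y) (hκ : 0 < κ)
    {A : H →L[ℝ] H} {α s : ℝ} (hα : 0 < α) (hA : ‖A‖ ≤ α) (hs0 : 0 ≤ s)
    (hs : ∫ x, ‖A (feat H x)‖ ^ 2 ∂ν.fst ≤ s ^ 2) {n ℓ : ℕ} (hℓ : 1 ≤ ℓ) (hℓn : ℓ ≤ n) {t : ℝ}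
    (hτ : tauCoeff P Z (n / ℓ) ≤ ENNReal.ofReal t)
    (hδ : ℓ = 1 ∨ 2 * κ * α * t ≤ max (2 * α / (ℓ : ℝ)) (s / √(ℓ : ℝ)))
    {η : ℝ} (hη : 0 < η) (hη' : η ≤ 1 / 2) :
    ENNReal.ofReal (1 - η) ≤ P {ω |
      ‖A * (covOp H ν.fst - empCovOp H (fun j : Fin n => (Z j ω).1))‖
        ≤ 4 * Real.log (2 * η⁻¹) * max (2 * α / (ℓ : ℝ)) (s / √(ℓ : ℝ)) ∧
      hsNorm (A * (covOp H ν.fst - empCovOp H (fun j : Fin n => (Z j ω).1)))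
        ≤ ENNReal.ofReal (4 * Real.log (2 * η⁻¹) * max (2 * α / (ℓ : ℝ)) (s / √(ℓ : ℝ)))} := by
  have hc := continuous_feat hL
  have hn0 : (n : ℝ) ≠ 0 := by
    have : n ≠ 0 := by omega
    exact_mod_cast this
  set Φ : X → HSSpace H := fun x => hsRankOne (feat H x) (A (feat H x)) with hΦ
  have hAf : ∀ x : X, ‖A (feat H x)‖ ≤ α := fun x => by
    simpa using A.le_of_opNorm_le_of_le hA (h1 x)
  have hΦL : ∀ x y, ‖Φ x - Φ y‖ ≤ 2 * κ * α * dist x y := fun x y => by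
    refine (norm_hsRankOne_sub_le _ _ _ _).trans ?_
    have e1 := hL x y
    have e2 : ‖A (feat H x) - A (feat H y)‖ ≤ α * (κ * dist x y) := by
      rw [← map_sub]; exact A.le_of_opNorm_le_of_le hA (hL x y)
    calc _ ≤ (κ * dist x y) * α + 1 * (α * (κ * dist x y)) := by
          gcongr
          · exact hAf x
          · exact h1 y
      _ = _ := by ring
  have hΦc : Continuous Φ :=
    (LipschitzWith.of_dist_le' (K := 2 * κ * α) fun x y => by
      rw [dist_eq_norm]; exact hΦL x y).continuous
  have hΦB : ∀ x, ‖Φ x‖ ≤ α := fun x => by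
    rw [hΦ, norm_hsRankOne]
    calc _ ≤ 1 * α := mul_le_mul (h1 x) (hAf x) (norm_nonneg _) zero_le_one
      _ = α := one_mul _
  have hΦi : Integrable Φ ν.fst := integrable_of_continuous_of_bound hΦc hΦB
  set m₀ : HSSpace H := ∫ x, Φ x ∂ν.fst with hm₀
  have hm₀B : ‖m₀‖ ≤ α := by
    simpa using norm_integral_le_of_norm_le_const (μ := ν.fst) (ae_of_all _ hΦB)
  -- the coordinates of `F (x, y)` are those of `A (T - T_x)`
  set F : X × ℝ → HSSpace H := fun z => m₀ - Φ z.1 with hF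
  have hFc : Continuous F := continuous_const.sub (hΦc.comp continuous_fst)
  have hfst : ∀ g : X → ℝ, Continuous g → ∫ z, g z.1 ∂ν = ∫ x, g x ∂ν.fst := fun g hg => by
    rw [Measure.fst, integral_map measurable_fst.aemeasurable
      hg.stronglyMeasurable.aestronglyMeasurable]
  have hinner : ∀ v, Integrable (fun x => (inner ℝ v (Φ x) : ℝ)) ν.fst := fun v =>
    hΦi.const_inner v
  have hmean : ∀ v : HSSpace H, ∫ z, inner ℝ v (F z) ∂ν = 0 := fun v => by
    rw [hfst (fun x => inner ℝ v (m₀ - Φ x))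
      (continuous_const.inner (continuous_const.sub hΦc))]
    simp only [inner_sub_right]
    rw [integral_sub (integrable_const _) (hinner v), integral_inner hΦi]
    simp [hm₀]
  have hvar : ∫ z, ‖F z‖ ^ 2 ∂ν ≤ s ^ 2 := by
    rw [hfst (fun x => ‖m₀ - Φ x‖ ^ 2) ((continuous_const.sub hΦc).norm.pow 2)]
    have hAi : Integrable (fun x : X => ‖A (feat H x)‖ ^ 2) ν.fst :=
      integrable_of_continuous_of_bound (B := α ^ 2) ((A.continuous.comp hc).norm.pow 2)
        fun x => by
          rw [Real.norm_of_nonneg (by positivity)]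
          have := hAf x
          gcongr
    have hmi : Integrable (fun x => 2 * (inner ℝ m₀ (Φ x) : ℝ)) ν.fst := (hinner m₀).const_mul 2
    have hci : Integrable (fun _ : X => ‖m₀‖ ^ 2) ν.fst := integrable_const _
    have hi2 : Integrable (fun x => ‖m₀‖ ^ 2 - 2 * (inner ℝ m₀ (Φ x) : ℝ)) ν.fst := hci.sub hmi
    calc ∫ x, ‖m₀ - Φ x‖ ^ 2 ∂ν.fst
        ≤ ∫ x, (‖m₀‖ ^ 2 - 2 * inner ℝ m₀ (Φ x) + ‖A (feat H x)‖ ^ 2) ∂ν.fst := by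
          refine integral_mono_of_nonneg (ae_of_all _ fun x => by positivity)
            (hi2.add hAi) (ae_of_all _ fun x => ?_)
          simp only
          rw [norm_sub_sq_real, hΦ, norm_hsRankOne, mul_pow]
          have : ‖feat H x‖ ^ 2 ≤ 1 := pow_le_one₀ (norm_nonneg _) (h1 x)
          nlinarith [sq_nonneg ‖A (feat H x)‖]
      _ = -‖m₀‖ ^ 2 + ∫ x, ‖A (feat H x)‖ ^ 2 ∂ν.fst := by
          rw [integral_add hi2 hAi, integral_sub hci hmi, integral_const_mul, integral_inner hΦi,
            ← hm₀, real_inner_self_eq_norm_sq]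
          simp
          ring
      _ ≤ s ^ 2 := by nlinarith [sq_nonneg ‖m₀‖]
  have key := prob_norm_average_le_of_law hZ hν hFc (by positivity : 0 < 2 * α)
    (by positivity : 0 < 2 * κ * α)
    (fun z => (norm_sub_le _ _).trans (by linarith [hm₀B, hΦB z.1]))
    (fun z w => by
      have e : F z - F w = -(Φ z.1 - Φ w.1) := by rw [hF]; simp
      rw [e, norm_neg]
      refine (hΦL _ _).trans ?_
      gcongr
      linarith [abs_nonneg (z.2 - w.2)])
    hℓ hℓn hτ hδ hmean hvar hs0 hη hη'
  refine key.trans (measure_mono fun ω hω => ?_)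
  have hcoord : ∀ i, ((n : ℝ)⁻¹ • ∑ j : Fin n, F (Z j ω)) i
      = (A * (covOp H ν.fst - empCovOp H (fun j : Fin n => (Z j ω).1))) (onb H i) := by
    intro i
    have hΦapp : ∀ x, Φ x i = A (rankOneOp H x (onb H i)) := fun x => by
      rw [hΦ, hsRankOne_apply, rankOneOp, InnerProductSpace.rankOne_apply, map_smul]
    have hm₀i : m₀ i = A (covOp H ν.fst (onb H i)) := by
      have e1 := (lp.evalCLM ℝ (fun _ : (exists_hilbertBasis ℝ H).choose => H) 2
        i).integral_comp_comm hΦi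
      have e2 := A.integral_comp_comm (integrable_inner_smul_feat (μ := ν.fst) hc h1 (onb H i))
      rw [covOp_apply hc h1, ← e2]
      change _ = m₀ i at e1
      rw [← e1]
      exact integral_congr_ae (ae_of_all _ fun x => hΦapp x)
    rw [lp.coeFn_smul, Pi.smul_apply, lp.coeFn_sum, Finset.sum_apply]
    simp only [hF, lp.coeFn_sub, Pi.sub_apply, hm₀i, hΦapp]
    rw [Finset.sum_sub_distrib, Finset.sum_const, Finset.card_univ, Fintype.card_fin, smul_sub,
      ← Nat.cast_smul_eq_nsmul ℝ, smul_smul, inv_mul_cancel₀ hn0, one_smul]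
    simp only [mul_apply_eq_comp, _root_.sub_apply, map_sub, empCovOp,
      _root_.smul_apply, _root_.sum_apply, map_smul, map_sum]
  refine ⟨(norm_le_of_hs hcoord).trans hω, ?_⟩
  rw [hsNorm_eq_of_hs hcoord]
  exact ENNReal.ofReal_le_ofReal hω

end Deviations

/-! ### Admissible effective sample sizes -/

section AdmissibleSizes

/-- `ℓ` is an admissible effective sample size for the mixing rate `δ`: either the trivial value
`1`, or the rate at distance `⌊n / ℓ⌋` is dominated by the independent-sample bound. -/
def IsAdmissibleSize (δ : ℕ → ℝ) (c σ : ℝ) (n ℓ : ℕ) : Prop :=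
  1 ≤ ℓ ∧ ℓ ≤ n ∧ (ℓ = 1 ∨ δ (n / ℓ) ≤ max (c / (ℓ : ℝ)) (σ / √(ℓ : ℝ)))

/-- The fallback value `1` of `effSize`, for an empty set of candidates, is admissible as well. -/
theorem isAdmissibleSize_effSize (δ : ℕ → ℝ) (c σ : ℝ) {n : ℕ} (hn : 1 ≤ n) :
    IsAdmissibleSize δ c σ n (effSize δ c σ n) := by
  classical
  unfold effSize
  set S := (Finset.Icc 1 n).filter
    fun ℓ => δ (n / ℓ) ≤ max (c / (ℓ : ℝ)) (σ / √(ℓ : ℝ)) with hS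
  rcases S.eq_empty_or_nonempty with h | h
  · rw [h]
    exact ⟨le_rfl, hn, Or.inl rfl⟩
  · obtain ⟨ℓ, hℓ, he⟩ := S.exists_mem_eq_sup h id
    have hm := hℓ
    rw [hS, Finset.mem_filter, Finset.mem_Icc] at hm
    rw [he, id_eq, max_eq_right hm.1.1]
    exact ⟨hm.1.1, hm.1.2, Or.inr hm.2⟩

theorem one_le_clip (n : ℕ) (a : ℝ) : 1 ≤ clip n a := le_max_left _ _

theorem clip_le {n : ℕ} (hn : 1 ≤ n) (a : ℝ) : clip n a ≤ n := max_le hn (min_le_left _ _)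

theorem clip_eq_one_or_le (n : ℕ) {a : ℝ} (ha : 0 ≤ a) : clip n a = 1 ∨ (clip n a : ℝ) ≤ a := by
  rcases le_total (min n ⌊a⌋₊) 1 with h | h
  · exact Or.inl (max_eq_left h)
  · right
    rw [clip, max_eq_right h]
    exact (Nat.cast_le.2 (min_le_right _ _)).trans (Nat.floor_le ha)

/-- Rounding `n / ℓ` down costs at most a factor `2`. -/
theorem half_div_le_natDiv {n ℓ : ℕ} (h1 : 1 ≤ ℓ) (hn : ℓ ≤ n) :
    (n : ℝ) / 2 / ℓ ≤ ((n / ℓ : ℕ) : ℝ) := by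
  have hℓ : (0 : ℝ) < ℓ := by exact_mod_cast h1
  have hk : 1 ≤ n / ℓ := (Nat.one_le_div_iff (by omega)).2 hn
  have h : n ≤ 2 * (n / ℓ) * ℓ := by
    have h2 := Nat.div_add_mod n ℓ
    have h3 := Nat.mod_lt n h1
    nlinarith
  rw [div_div, div_le_iff₀ (by positivity)]
  have h' : (n : ℝ) ≤ 2 * ((n / ℓ : ℕ) : ℝ) * ℓ := by exact_mod_cast h
  linarith

/-- For an exponential rate the term `c / ℓ` dominates. With `Λ = 1 ∨ log (n q)`, the size is such
that `(θ ⌊n / ℓ⌋) ^ γ ≥ Λ`, hence `exp (-(θ ⌊n / ℓ⌋) ^ γ) ≤ 1 / (n q)`. -/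
theorem isAdmissibleSize_expSize {δ : ℕ → ℝ} {c σ θ γ q : ℝ} {n : ℕ} (hn : 1 ≤ n) (hc : 0 < c)
    (hθ : 0 < θ) (hγ : 0 < γ) (hq : 0 < q)
    (hδ : ∀ k : ℕ, δ k = q * c / θ * Real.exp (-(θ * (k : ℝ)) ^ γ)) :
    IsAdmissibleSize δ c σ n (expSize n θ γ q) := by
  have hn0 : (0 : ℝ) < n := by exact_mod_cast hn
  unfold expSize
  set Λ := max 1 (Real.log (n * q)) with hΛ
  have hΛ1 : 1 ≤ Λ := le_max_left _ _
  have hpow : 1 ≤ Λ ^ (1 / γ) := Real.one_le_rpow hΛ1 (by positivity)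
  set a := n * θ / (2 * Λ ^ (1 / γ)) with ha
  refine ⟨one_le_clip _ _, clip_le hn _, ?_⟩
  refine (clip_eq_one_or_le n (by positivity : 0 ≤ a)).imp_right fun hle => ?_
  have hℓ1 := one_le_clip n a
  have hk := half_div_le_natDiv hℓ1 (clip_le hn a)
  set ℓ := clip n a
  have hℓ0 : (0 : ℝ) < ℓ := by exact_mod_cast hℓ1
  have hle2 : (ℓ : ℝ) * (2 * Λ ^ (1 / γ)) ≤ n * θ := (le_div_iff₀ (by positivity)).1 hle
  have h1 : Λ ^ (1 / γ) ≤ θ * ((n / ℓ : ℕ) : ℝ) := by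
    calc Λ ^ (1 / γ) ≤ θ * ((n : ℝ) / 2 / ℓ) := by
          rw [← mul_div_assoc, le_div_iff₀ hℓ0]; linarith
      _ ≤ _ := by gcongr
  have h2 : Λ ≤ (θ * ((n / ℓ : ℕ) : ℝ)) ^ γ := by
    have := Real.rpow_le_rpow (by positivity) h1 hγ.le
    rwa [← Real.rpow_mul (by positivity), one_div_mul_cancel hγ.ne', Real.rpow_one] at this
  have h3 : Real.exp (-(θ * ((n / ℓ : ℕ) : ℝ)) ^ γ) ≤ (n * q)⁻¹ := by
    rw [← Real.exp_log (by positivity : 0 < (n * q : ℝ)), ← Real.exp_neg, Real.exp_le_exp]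
    linarith [le_max_right 1 (Real.log (n * q))]
  refine le_max_of_le_left ?_
  calc δ (n / ℓ) ≤ q * c / θ * (n * q)⁻¹ := by rw [hδ]; gcongr
    _ = c / (n * θ) := by field_simp
    _ ≤ c / ℓ := by gcongr; nlinarith

/-- For a polynomial rate the term `σ / √ℓ` dominates: the size is the solution `ℓ` of
`ℓ ^ γ √ℓ = q (n / 2) ^ γ`. Nothing excludes `q = 0`, where the size is `1`. -/
theorem isAdmissibleSize_polySize {δ : ℕ → ℝ} {c σ γ q β : ℝ} {n : ℕ} (hn : 1 ≤ n)
    (hγ : 0 < γ) (hq : 0 ≤ q) (hβ : 0 < β) (hσ : σ = β * q)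
    (hδ : ∀ k : ℕ, δ k = β * (k : ℝ) ^ (-γ)) :
    IsAdmissibleSize δ c σ n (polySize n γ q) := by
  have hn0 : (0 : ℝ) < n := by exact_mod_cast hn
  unfold polySize
  set a := q ^ (2 / (2 * γ + 1)) * ((n : ℝ) / 2) ^ (2 * γ / (2 * γ + 1)) with ha
  refine ⟨one_le_clip _ _, clip_le hn _, ?_⟩
  refine (clip_eq_one_or_le n (by positivity : 0 ≤ a)).imp_right fun hle => ?_
  have hℓ1 := one_le_clip n a
  have hk := half_div_le_natDiv hℓ1 (clip_le hn a)
  set ℓ := clip n a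
  have hℓ0 : (0 : ℝ) < ℓ := by exact_mod_cast hℓ1
  have hpow : (ℓ : ℝ) ^ γ * √(ℓ : ℝ) ≤ q * ((n : ℝ) / 2) ^ γ := by
    have h := Real.rpow_le_rpow hℓ0.le hle (by positivity : 0 ≤ (2 * γ + 1) / 2)
    rw [ha, Real.mul_rpow (by positivity) (by positivity), ← Real.rpow_mul hq,
      ← Real.rpow_mul (by positivity)] at h
    have e1 : 2 / (2 * γ + 1) * ((2 * γ + 1) / 2) = 1 := by field_simp
    have e2 : 2 * γ / (2 * γ + 1) * ((2 * γ + 1) / 2) = γ := by field_simp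
    have e3 : (2 * γ + 1) / 2 = γ + 1 / 2 := by ring
    rwa [e1, e2, e3, Real.rpow_one, Real.rpow_add hℓ0, ← Real.sqrt_eq_rpow] at h
  have hrate : (((n / ℓ : ℕ) : ℝ)) ^ (-γ) ≤ (ℓ : ℝ) ^ γ / ((n : ℝ) / 2) ^ γ := by
    refine (Real.rpow_le_rpow_of_nonpos (by positivity) hk (by linarith)).trans_eq ?_
    rw [Real.rpow_neg (by positivity), Real.div_rpow (by positivity) hℓ0.le, inv_div]
  refine le_max_of_le_right ?_
  rw [hδ, hσ, mul_div_assoc]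
  gcongr
  refine hrate.trans ?_
  rw [div_le_div_iff₀ (by positivity) (by positivity)]
  exact hpow

end AdmissibleSizes

/-! ### The four deviation inequalities -/

section FourInequalities

variable {Ω : Type*} [MeasurableSpace Ω] {P : Measure Ω} [IsProbabilityMeasure P]
  {X : Type*} [PseudoMetricSpace X] [SecondCountableTopology X] [MeasurableSpace X]
  [BorelSpace X] {Z : ℕ → Ω → X × ℝ} {ν : Measure (X × ℝ)} [IsProbabilityMeasure ν]
  {H : Type*} [NormedAddCommGroup H] [InnerProductSpace ℝ H] [CompleteSpace H]
  [SecondCountableTopology H] [RKHS ℝ H X ℝ] {κ : ℝ}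

/-- The first and fourth inequalities are the cases `A = 1`, the second and third the cases
`A = (T + lam)^{-1/2}`, of the deviation bounds seen through an operator `A`. -/
theorem deviationBounds_of_isAdmissibleSize {f : H} {R Sig D : ℝ}
    (h : RegressionClass ν f R Sig) (hZ : ∀ j, Measurable (Z j)) (hν : ∀ j, P.map (Z j) = ν)
    (h1 : ∀ x : X, ‖feat H x‖ ≤ 1)
    (hL : ∀ x y : X, ‖feat H x - feat H y‖ ≤ κ * dist x y) (hκ : 0 < κ) (hD : ‖f‖ ≤ D)
    {n : ℕ} {η lam : ℝ} (hη : 0 < η) (hη' : η ≤ 1 / 2) (hlam : 0 < lam) {τ : ℕ → ℝ}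
    (hτ : ∀ k, 1 ≤ k → tauCoeff P Z k ≤ ENNReal.ofReal (τ k)) {ℓ₁ ℓ₂ ℓ₃ ℓ₄ : ℕ}
    (h₁ : IsAdmissibleSize (fun k => constC κ R D * τ k) (2 * R) Sig n ℓ₁)
    (h₂ : IsAdmissibleSize (fun k => constC κ R D / √lam * τ k) (2 * R / √lam)
      (Sig * √(effDim (covOp H ν.fst) lam)) n ℓ₂)
    (h₃ : IsAdmissibleSize (fun k => 2 * κ / √lam * τ k) (2 / √lam)
      (√(effDim (covOp H ν.fst) lam)) n ℓ₃)
    (h₄ : IsAdmissibleSize (fun k => 2 * κ * τ k) 2 2 n ℓ₄) :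
    DeviationBounds P Z ν.fst f R Sig n η lam ℓ₁ ℓ₂ ℓ₃ ℓ₄ := by
  have hc := continuous_feat hL
  have hR := h.R_pos
  have hSig := h.Sig_pos
  have hlam' : 0 < √lam := Real.sqrt_pos.2 hlam
  have hB : 0 ≤ Real.log (2 * η⁻¹) := by
    refine Real.log_nonneg ?_
    have : (2 : ℝ) ≤ η⁻¹ := by rw [le_inv_comm₀ (by norm_num) hη]; linarith
    linarith
  set B := Real.log (2 * η⁻¹)
  have hmax : ∀ {a b : ℝ}, 0 ≤ a → 0 ≤ b → 4 * B * max a b ≤ 21 * B * (b + a) := by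
    intro a b ha hb
    have : max a b ≤ b + a := max_le (by linarith) (by linarith)
    calc 4 * B * max a b ≤ 21 * B * max a b := by gcongr; norm_num
      _ ≤ _ := by gcongr
  have hτ' : ∀ {ℓ}, 1 ≤ ℓ → ℓ ≤ n → tauCoeff P Z (n / ℓ) ≤ ENNReal.ofReal (τ (n / ℓ)) :=
    fun hℓ hℓn => hτ _ ((Nat.one_le_div_iff (by omega)).2 hℓn)
  have hid : ‖(1 : H →L[ℝ] H)‖ ≤ 1 := ContinuousLinearMap.norm_id_le
  have hone : ∫ x, ‖(1 : H →L[ℝ] H) (feat H x)‖ ^ 2 ∂ν.fst ≤ 1 := by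
    have : ∫ x, ‖(1 : H →L[ℝ] H) (feat H x)‖ ^ 2 ∂ν.fst ≤ ∫ _, 1 ∂ν.fst :=
      integral_mono_of_nonneg (ae_of_all _ fun x => by positivity) (integrable_const _)
        (ae_of_all _ fun x => pow_le_one₀ (norm_nonneg _) (h1 x))
    simpa using this
  have hT := isPositive_covOp (μ := ν.fst) hc h1
  have hinv := isInvSqrt_invSqrt hT hlam
  have hN := effDim_eq_integral (μ := ν.fst) hc h1 hlam
  have hAn := hinv.norm_le hT hlam
  set A := invSqrt (covOp H ν.fst + lam • (1 : H →L[ℝ] H))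
  set N := effDim (covOp H ν.fst) lam
  have hN0 : 0 ≤ N := by rw [hN]; exact integral_nonneg fun x => by positivity
  have hA2 : ∫ x, ‖A (feat H x)‖ ^ 2 ∂ν.fst ≤ √N ^ 2 := by rw [Real.sq_sqrt hN0, hN]
  refine ⟨?_, ?_, ?_, ?_⟩
  · obtain ⟨hℓ, hℓn, hδ⟩ := h₁
    refine (h.prob_norm_residual_le (α := 1) (s := 1) hZ hν h1 hL hκ hD one_pos hid zero_le_one
      (by simpa using hone) hℓ hℓn (hτ' hℓ hℓn) (by simpa using hδ) hη hη').trans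
      (measure_mono fun ω hω => ?_)
    refine (Set.mem_ofPred.1 hω).trans ?_
    rw [mul_one, mul_one]
    exact hmax (by positivity) (by positivity)
  · obtain ⟨hℓ, hℓn, hδ⟩ := h₂
    refine (h.prob_norm_residual_le hZ hν h1 hL hκ hD (inv_pos.2 hlam') hAn
      (Real.sqrt_nonneg N) hA2 hℓ hℓn (hτ' hℓ hℓn)
      (by simpa only [← div_eq_mul_inv] using hδ) hη hη').trans
      (measure_mono fun ω hω => ?_)
    refine (Set.mem_ofPred.1 hω).trans ?_
    rw [← div_eq_mul_inv (2 * R), div_div]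
    exact hmax (by positivity) (by positivity)
  · obtain ⟨hℓ, hℓn, hδ⟩ := h₃
    have hb : 4 * B * max (2 * (√lam)⁻¹ / (ℓ₃ : ℝ)) (√N / √(ℓ₃ : ℝ))
        ≤ 21 * B * (√N / √(ℓ₃ : ℝ) + 2 / (√lam * (ℓ₃ : ℝ))) := by
      rw [← div_eq_mul_inv (2 : ℝ) (√lam), div_div]
      exact hmax (by positivity) (by positivity)
    exact (prob_norm_covOp_sub_le hZ hν h1 hL hκ (inv_pos.2 hlam') hAn
      (Real.sqrt_nonneg N) hA2 hℓ hℓn (hτ' hℓ hℓn)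
      (by simpa only [← div_eq_mul_inv] using hδ) hη hη').trans
      (measure_mono fun ω hω => ⟨hω.1.trans hb, hω.2.trans (ENNReal.ofReal_le_ofReal hb)⟩)
  · obtain ⟨hℓ, hℓn, hδ⟩ := h₄
    have hℓ1 : (1 : ℝ) ≤ ℓ₄ := by exact_mod_cast hℓ
    have hb : 4 * B * max (2 * 1 / (ℓ₄ : ℝ)) (2 / √(ℓ₄ : ℝ)) ≤ 42 * (B / √(ℓ₄ : ℝ)) := by
      have hs : √(ℓ₄ : ℝ) ≤ ℓ₄ := Real.sqrt_le_self_iff.2 (Or.inr hℓ1)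
      have hs0 : 0 < √(ℓ₄ : ℝ) := Real.sqrt_pos.2 (by linarith)
      have : max (2 * 1 / (ℓ₄ : ℝ)) (2 / √(ℓ₄ : ℝ)) = 2 / √(ℓ₄ : ℝ) :=
        max_eq_right (by rw [mul_one]; gcongr)
      rw [this]
      calc 4 * B * (2 / √(ℓ₄ : ℝ)) = 8 * (B / √(ℓ₄ : ℝ)) := by ring
        _ ≤ _ := by gcongr; norm_num
    refine (prob_norm_covOp_sub_le (α := 1) (s := 2) hZ hν h1 hL hκ one_pos hid zero_le_two
      (hone.trans (by norm_num)) hℓ hℓn (hτ' hℓ hℓn) (by simpa using hδ) hη hη').trans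
      (measure_mono fun ω hω => ?_)
    rw [Set.mem_ofPred_eq, one_mul] at hω
    exact ⟨hω.1.trans hb, hω.2.trans (ENNReal.ofReal_le_ofReal hb)⟩

end FourInequalities

end TauMixRKHS

open TauMixRKHS in
theorem lemma4p1
    {E : Type*} [NormedAddCommGroup E] [NormedSpace ℝ E] [CompleteSpace E]
    [SecondCountableTopology E] [MeasurableSpace E] [BorelSpace E]
    (x₀ : E) (r : ℝ)
    {H : Type*} [NormedAddCommGroup H] [InnerProductSpace ℝ H] [CompleteSpace H]
    [SecondCountableTopology H] [RKHS ℝ H (Metric.closedBall x₀ r) ℝ]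
    (hk_meas : Measurable fun p : Metric.closedBall x₀ r × Metric.closedBall x₀ r =>
      ker H p.1 p.2)
    (hk_bdd : ∀ x : Metric.closedBall x₀ r, √(ker H x x) ≤ 1)
    (K : ℝ) (hK : 0 < K)
    (hk_deriv : HasBoundedMixedDeriv (fun x y : Metric.closedBall x₀ r => ker H x y) K)
    {Ω : Type*} [MeasurableSpace Ω] (P : Measure Ω) [IsProbabilityMeasure P]
    (Z : ℕ → Ω → Metric.closedBall x₀ r × ℝ) (hZ : ∀ j, Measurable (Z j))
    (ν : Measure (Metric.closedBall x₀ r × ℝ)) [IsProbabilityMeasure ν]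
    (hν : ∀ j, P.map (Z j) = ν)
    (fν : H) (R Sig D : ℝ) (hB1 : RegressionClass ν fν R Sig) (hD : ‖fν‖ ≤ D)
    (n : ℕ) (hn : 1 ≤ n) (η : ℝ) (hη : 0 < η) (hη' : η ≤ 1 / 2) (lam : ℝ) (hlam : 0 < lam) :
    -- general mixing rate: the sizes are the effective sample sizes of the four sums
    (∀ τ : ℕ → ℝ, (∀ k, 1 ≤ k → tauCoeff P Z k ≤ ENNReal.ofReal (τ k)) →
      DeviationBounds P Z ν.fst fν R Sig n η lam
        (effSize (fun k => constC (kerLip K) R D * τ k) (2 * R) Sig n)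
        (effSize (fun k => constC (kerLip K) R D / √lam * τ k) (2 * R / √lam)
          (Sig * √(effDim (covOp H ν.fst) lam)) n)
        (effSize (fun k => 2 * kerLip K / √lam * τ k) (2 / √lam)
          (√(effDim (covOp H ν.fst) lam)) n)
        (effSize (fun k => 2 * kerLip K * τ k) 2 2 n)) ∧
    -- exponential mixing rate
    (∀ χ θ γ : ℝ, 0 < χ → 0 < θ → 0 < γ →
      (∀ k : ℕ, 1 ≤ k →
        tauCoeff P Z k ≤ ENNReal.ofReal (χ * Real.exp (-(θ * (k : ℝ)) ^ γ))) →
      DeviationBounds P Z ν.fst fν R Sig n η lam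
        (expSize n θ γ (constC (kerLip K) R D * χ * θ / (2 * R)))
        (expSize n θ γ (constC (kerLip K) R D * χ * θ / (2 * R)))
        (expSize n θ γ (kerLip K * θ * χ))
        (expSize n θ γ (kerLip K * θ * χ))) ∧
    -- polynomial mixing rate
    (∀ ρ γ : ℝ, 0 < ρ → 0 < γ →
      (∀ k : ℕ, 1 ≤ k → tauCoeff P Z k ≤ ENNReal.ofReal (ρ * (k : ℝ) ^ (-γ))) →
      DeviationBounds P Z ν.fst fν R Sig n η lam
        (polySize n γ (Sig / (constC (kerLip K) R D * ρ)))
        (polySize n γ (Sig * √(lam * effDim (covOp H ν.fst) lam)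
          / (constC (kerLip K) R D * ρ)))
        (polySize n γ (√(lam * effDim (covOp H ν.fst) lam) / (2 * kerLip K * ρ)))
        (polySize n γ (1 / (kerLip K * ρ)))) := by
  have h1 : ∀ x : Metric.closedBall x₀ r, ‖feat H x‖ ≤ 1 := fun x => norm_feat_le (hk_bdd x)
  have hL := norm_feat_sub_le (H := H) (convex_closedBall x₀ r) hk_deriv
  have hκ : 0 < kerLip K := lt_max_of_lt_left hK
  have hR := hB1.R_pos
  have hSig := hB1.Sig_pos
  have hlam' : 0 < √lam := Real.sqrt_pos.2 hlam
  set κ := kerLip K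
  have hC := constC_pos κ R D
  refine ⟨fun τ hτ => ?_, fun χ θ γ hχ hθ hγ hτ => ?_, fun ρ γ hρ hγ hτ => ?_⟩
  · exact deviationBounds_of_isAdmissibleSize hB1 hZ hν h1 hL hκ hD hη hη' hlam hτ
      (isAdmissibleSize_effSize _ _ _ hn) (isAdmissibleSize_effSize _ _ _ hn)
      (isAdmissibleSize_effSize _ _ _ hn) (isAdmissibleSize_effSize _ _ _ hn)
  · refine deviationBounds_of_isAdmissibleSize hB1 hZ hν h1 hL hκ hD hη hη' hlam
      (τ := fun k => χ * Real.exp (-(θ * (k : ℝ)) ^ γ)) hτ ?_ ?_ ?_ ?_ <;>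
    refine isAdmissibleSize_expSize hn (by positivity) hθ hγ (by positivity) fun k => ?_ <;>
    field_simp
  · refine deviationBounds_of_isAdmissibleSize hB1 hZ hν h1 hL hκ hD hη hη' hlam
      (τ := fun k => ρ * (k : ℝ) ^ (-γ)) hτ ?_ ?_ ?_ ?_
    · exact isAdmissibleSize_polySize (β := constC κ R D * ρ) hn hγ (by positivity) (by positivity)
        (by field_simp) fun k => by ring
    · exact isAdmissibleSize_polySize (β := constC κ R D / √lam * ρ) hn hγ (by positivity) (by positivity)
        (by rw [Real.sqrt_mul hlam.le]; field_simp) fun k => by ring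
    · exact isAdmissibleSize_polySize (β := 2 * κ / √lam * ρ) hn hγ (by positivity)
        (by positivity) (by rw [Real.sqrt_mul hlam.le]; field_simp) fun k => by ring
    · exact isAdmissibleSize_polySize (β := 2 * κ * ρ) hn hγ (by positivity) (by positivity)
        (by field_simp) fun k => by ring
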